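/- All graphs are finite and simple. For a graph $G$ and a weighing $w:E(G)\to\{-1,1\}$ put $w(G)=\sum_{e\in E(G)}w(e)$, and define the weight of a subgraph likewise. For an integer $k\ge 1$, the weighing $w$ is $k$-local positive if every connected subgraph of $G$ with exactly $k$ edges has positive weight. Let $\mathcal G$ be an infinite family of connected graphs. We say that $k$ is forcing for $\mathcal G$ if for all but finitely many $G\in\mathcal G$, every $k$-local positive weighing $w$ of $G$ has $w(G)>0$. If $k$ is not forcing, it is weakly forcing for $\mathcal G$ if there is a constant $C$ such that for all but finitely many $G\in\mathcal G$, every $k$-local positive weighing $w$ of $G$ has $w(G)\ge C$; the maximum such $C$ is denoted $f_{\mathcal G}(k)$. If $k$ is neither forcing nor weakly forcing, it collapses for $\mathcal G$, and $c_{\mathcal G}(k)$ denotes the supremum of all $c\le 0$ such that $w(G)\ge c|E(G)|-o(|E(G)|)$ for all $G\in\mathcal G$ and all $k$-local positive weighings $w$ of $G$. For an integer $\Delta\ge 2$, let $\mathcal C_\Delta$ be the family of all connected graphs of maximum degree at most $\Delta$, let $\mathcal T_\Delta$ be the family of all trees of maximum degree at most $\Delta$, and let $\mathcal G_\Delta$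 be any family with $\mathcal T_\Delta\subseteq\mathcal G_\Delta\subseteq\mathcal C_\Delta$. **Theorem 2.** Every $k\ge 1$ is forcing for $\mathcal G_2$. For every $\Delta\ge 3$: 1. $k=1,2,3,4,6$ are forcing for $\mathcal G_\Delta$. 2. $k=5,8$ are weakly forcing for $\mathcal G_\Delta$, with $f_{\mathcal G_\Delta}(5)=-1$ and $f_{\mathcal G_\Delta}(8)=-1$. 3. $k=7$ and all $k\ge 9$ collapse for $\mathcal G_\Delta$. Furthermore, for these $k$: (a) if $k=4m+3$, then $-\frac{2m-1}{6m+5}\ge c_{\mathcal G_\Delta}(k)\ge-\frac{m}{3m+2}$; (b) if $k=4m+2$, then $-\frac{2m-3}{6m+3}\ge c_{\mathcal G_\Delta}(k)\ge-\frac{m-1}{3m+1}$; (c) if $k=4m+1$, then $-\frac{m-1}{3m+1}\ge c_{\mathcal G_\Delta}(k)\ge-\frac{2m-1}{6m+1}$; (d) if $k=4m$, then $-\frac{m-2}{3m}\ge c_{\mathcal G_\Delta}(k)\ge-\frac{2m-3}{6m-1}$. -/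

import Mathlib

open Filter Asymptotics

/-- A finite simple graph, on the vertex set `Fin n` for some `n`. Every finite simple graph is
isomorphic to one of these, and each isomorphism class has only finitely many members here, so
"finitely many" has the same meaning for these labelled graphs as up to isomorphism. -/
abbrev FinGraph : Type := (n : ℕ) × SimpleGraph (Fin n)

namespace FinGraph

/-- The vertex type of a finite graph. -/
abbrev V (G : FinGraph) : Type := Fin G.1

/-- The underlying simple graph. -/
abbrev graph (G : FinGraph) : SimpleGraph G.V := G.2

open Classical in
/-- The graph has maximum degree at most `Δ`. -/
def MaxDegreeLE (G : FinGraph) (Δ : ℕ) : Prop := G.graph.maxDegree ≤ Δ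

/-- The number of edges. -/
noncomputable def numEdges (G : FinGraph) : ℕ := G.graph.edgeSet.ncard

/-- `w` assigns `-1` or `1` to every edge (values off the edge set are irrelevant). -/
def IsWeighing (G : FinGraph) (w : Sym2 G.V → ℤ) : Prop :=
  ∀ e ∈ G.graph.edgeSet, w e = -1 ∨ w e = 1

open Classical in
/-- The total weight of a set of edges. -/
noncomputable def weight {G : FinGraph} (w : Sym2 G.V → ℤ) (S : Set (Sym2 G.V)) : ℤ :=
  ∑ e with e ∈ S, w e

/-- The total weight `w(G)` of the graph. -/
noncomputable def totalWeight (G : FinGraph) (w : Sym2 G.V → ℤ) : ℤ :=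
  weight w G.graph.edgeSet

/-- `w` is a `{-1,1}`-weighing of the edges of `G` such that every connected subgraph with
exactly `k` edges has positive weight. -/
def IsLocalPositive (G : FinGraph) (k : ℕ) (w : Sym2 G.V → ℤ) : Prop :=
  G.IsWeighing w ∧
    ∀ H : G.graph.Subgraph, H.Connected → H.edgeSet.ncard = k → 0 < weight w H.edgeSet

end FinGraph

/-- The connected graphs of maximum degree at most `Δ`. -/
def connectedGraphs (Δ : ℕ) : Set FinGraph := {G | G.graph.Connected ∧ G.MaxDegreeLE Δ}

/-- The trees of maximum degree at most `Δ`. -/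
def trees (Δ : ℕ) : Set FinGraph := {G | G.graph.IsTree ∧ G.MaxDegreeLE Δ}

/-- `P` holds for all but finitely many members of the family `𝒢`. -/
def ForAlmostAll (𝒢 : Set FinGraph) (P : FinGraph → Prop) : Prop := {G ∈ 𝒢 | ¬ P G}.Finite

/-- `k` is forcing for `𝒢`: for all but finitely many `G` in `𝒢`, every `k`-local positive
weighing has positive total weight. -/
def Forcing (𝒢 : Set FinGraph) (k : ℕ) : Prop :=
  ForAlmostAll 𝒢 fun G => ∀ w, G.IsLocalPositive k w → 0 < G.totalWeight w

/-- The constants `C` such that for all but finitely many `G` in `𝒢`, every `k`-local positive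
weighing has total weight at least `C`. -/
def lowerConstants (𝒢 : Set FinGraph) (k : ℕ) : Set ℝ :=
  {C | ForAlmostAll 𝒢 fun G => ∀ w, G.IsLocalPositive k w → C ≤ (G.totalWeight w : ℝ)}

/-- `k` is weakly forcing for `𝒢`. -/
def WeaklyForcing (𝒢 : Set FinGraph) (k : ℕ) : Prop :=
  ¬ Forcing 𝒢 k ∧ (lowerConstants 𝒢 k).Nonempty

/-- `k` is weakly forcing for `𝒢` and the maximum possible constant is `f`. -/
def WeaklyForcingWith (𝒢 : Set FinGraph) (k : ℕ) (f : ℝ) : Prop :=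
  WeaklyForcing 𝒢 k ∧ IsGreatest (lowerConstants 𝒢 k) f

/-- `k` collapses for `𝒢`: it is neither forcing nor weakly forcing. -/
def Collapses (𝒢 : Set FinGraph) (k : ℕ) : Prop :=
  ¬ Forcing 𝒢 k ∧ ¬ WeaklyForcing 𝒢 k

/-- The reals `c ≤ 0` such that `w(G) ≥ c |E(G)| - o(|E(G)|)` for all `G` in `𝒢` and all
`k`-local positive weighings `w` of `G`. -/
def collapseRates (𝒢 : Set FinGraph) (k : ℕ) : Set ℝ :=
  {c | c ≤ 0 ∧ ∃ g : ℕ → ℝ, g =o[atTop] (fun n : ℕ => (n : ℝ)) ∧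
    ∀ G ∈ 𝒢, ∀ w, G.IsLocalPositive k w →
      c * (G.numEdges : ℝ) - g G.numEdges ≤ (G.totalWeight w : ℝ)}

/-- The constant `c_𝒢(k)`: the supremum of `collapseRates 𝒢 k`. -/
noncomputable def collapseConstant (𝒢 : Set FinGraph) (k : ℕ) : ℝ := sSup (collapseRates 𝒢 k)

/-- The supremum in `collapseConstant` is a genuine least upper bound. -/
theorem isLUB_collapseConstant (𝒢 : Set FinGraph) (k : ℕ) :
    IsLUB (collapseRates 𝒢 k) (collapseConstant 𝒢 k) := by
  classical
  refine isLUB_csSup ⟨-1, by norm_num, fun _ => 0, isLittleO_zero _ _, ?_⟩ ⟨0, fun c hc => hc.1⟩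
  intro G _ w hw
  have h : -(G.numEdges : ℤ) ≤ G.totalWeight w := by
    unfold FinGraph.totalWeight FinGraph.weight FinGraph.numEdges
    rw [Set.ncard_eq_toFinset_card']
    have h1 : G.graph.edgeSet.toFinset
        = Finset.univ.filter (fun e => e ∈ G.graph.edgeSet) := by
      ext e; simp
    rw [h1]
    have h2 := Finset.card_nsmul_le_sum (Finset.univ.filter (fun e => e ∈ G.graph.edgeSet)) w (-1)
      (fun e he => by
        rcases hw.1 e (Finset.mem_filter.1 he).2 with h | h <;> omega)
    rw [smul_neg, nsmul_one] at h2
    exact le_trans h2 (le_of_eq (Finset.sum_congr (by ext e; simp) fun _ _ => rfl))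
  have h' : ((-(G.numEdges : ℤ) : ℤ) : ℝ) ≤ (G.totalWeight w : ℝ) := by exact_mod_cast h
  push_cast at h'
  linarith

/-!
Let `a = (k - 1) / 2` and `d = k - a`. A `k`-local positive weighing is one in which no connected
subgraph with `k` edges has more than `a` negative edges.

**Lower bounds.** A connected graph can be unfolded into a tree with the same edges, each edge
outside a spanning tree becoming pendant (`EdgeTree.exists_realizes`). Connected parts of this
tree are connected subgraphs of the graph, so only trees matter. In a tree with at least `k`
edges, every connected part with more than `a` negative edges has at least `d` positive ones,
since otherwise it could be shrunk or extended to a bad part with `k` edges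
(`EdgeTree.sparse_of_local`). Root the tree and prune branches of nonnegative value, for a
weighted count of the positive and negative edges. If this is no longer possible, at most `a`
negative edges are left: a lowest vertex with more of them below it would have several branches of
negative value, and these would form a connected part with more than `a` negative edges and fewer
than `d` positive ones (`EdgeTree.Sparse.reduce`). Counting a positive edge as `2 * a` and a
negative edge as `-d` shows that `a` negative edges need `d / 2` positive ones, which bounds the
collapse constant from below. Counting them as `1` and `-1` is possible for `2 * a ≤ d + 1`, that
is, for `k = 1, 2, 3, 4, 5, 6, 8`, and shows that the weight is at least `d - 2 * a`
(`EdgeTree.Sparse.sharp_bound`). This is `-1` for `k = 5, 8`, and nonnegative for the others. In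
the latter case, a large tree of bounded degree splits into two large parts and an edge, which
makes its weight positive (`EdgeTree.two_mul_count_lt_of_local`). For maximum degree two, the tree
consists of at most two paths, which are cut into windows of `k` edges.

**Upper bounds.** Take a path with `a` negative, `d` positive and `a` negative edges. Place many
copies of it in a row, let `xy` be the middle positive edge of each, and join the `y` of each copy
to the `x` of the next by a further positive edge. Any two negative paths are then joined by at
least `d` positive edges, which makes the weighing `k`-local positive (`comb_isLocalPositive`). A
comb of `n` copies has maximum degree at most three, `n * (d + 2 * a + 1) - 1` edges and weight
`n * (d + 1 - 2 * a) - 1`. This weight is always `-1` for `k = 5, 8`, and it tends to `-∞`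
linearly for `k = 7` and `k ≥ 9`.
-/

/-! ### Edge trees -/

/-- A rooted tree with labelled edges, seen from its root and stored in left-child right-sibling
form: `nil` is a root without branches, and `cons e child sib` is a root with a branch that starts
with the edge `e` and continues at its far end as `child`, next to the remaining branches `sib`. -/
inductive EdgeTree (ε : Type*) where
  | nil : EdgeTree ε
  | cons (e : ε) (child sib : EdgeTree ε) : EdgeTree ε

namespace EdgeTree

variable {ε : Type*}

/-- The list of edge labels. -/
def edges : EdgeTree ε → List ε
  | nil => []
  | cons e c r => e :: (c.edges ++ r.edges)

/-- The number of edges. -/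
def size : EdgeTree ε → ℕ
  | nil => 0
  | cons _ c r => c.size + r.size + 1

/-- The number of edges whose label satisfies `P`. -/
def count (P : ε → Prop) [DecidablePred P] : EdgeTree ε → ℕ
  | nil => 0
  | cons e c r => c.count P + r.count P + if P e then 1 else 0

/-- The number of branches at the root. -/
def deg : EdgeTree ε → ℕ
  | nil => 0
  | cons _ _ r => r.deg + 1

/-- Every vertex other than the root has at most `D` branches, that is, at most `D` children. -/
def ChildDegLE (D : ℕ) : EdgeTree ε → Prop
  | nil => True
  | cons _ c r => c.deg ≤ D ∧ c.ChildDegLE D ∧ r.ChildDegLE D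

theorem ChildDegLE.mono {D D' : ℕ} (h : D ≤ D') : ∀ {T : EdgeTree ε}, T.ChildDegLE D →
    T.ChildDegLE D'
  | .nil, _ => trivial
  | .cons _ _ _, ⟨h₁, h₂, h₃⟩ => ⟨h₁.trans h, h₂.mono h, h₃.mono h⟩

/-! ### Connected parts of edge trees -/

/-- `RootedSub S T`: `S` is a connected part of `T` that contains the root of `T`. -/
inductive RootedSub : EdgeTree ε → EdgeTree ε → Prop
  | nil (T : EdgeTree ε) : RootedSub nil T
  | cons (e : ε) {c' c r' r : EdgeTree ε} :
    RootedSub c' c → RootedSub r' r → RootedSub (cons e c' r') (cons e c r)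
  | drop (e : ε) (c : EdgeTree ε) {s r : EdgeTree ε} : RootedSub s r → RootedSub s (cons e c r)

/-- `ConnSub S T`: `S` is a connected part of `T`, rooted at the vertex nearest to the root of `T`. -/
inductive ConnSub : EdgeTree ε → EdgeTree ε → Prop
  | root {s t : EdgeTree ε} : RootedSub s t → ConnSub s t
  | child (e : ε) (r : EdgeTree ε) {s c : EdgeTree ε} : ConnSub s c → ConnSub s (cons e c r)
  | sib (e : ε) (c : EdgeTree ε) {s r : EdgeTree ε} : ConnSub s r → ConnSub s (cons e c r)

theorem RootedSub.refl : ∀ T : EdgeTree ε, RootedSub T T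
  | .nil => .nil _
  | .cons e c r => .cons e (RootedSub.refl c) (RootedSub.refl r)

theorem RootedSub.trans {s t u : EdgeTree ε} (h : RootedSub s t) (h' : RootedSub t u) :
    RootedSub s u := by
  induction h' generalizing s with
  | nil T => cases h; exact .nil _
  | cons e _ _ ih₁ ih₂ =>
    cases h with
    | nil => exact .nil _
    | cons _ h₁ h₂ => exact .cons e (ih₁ h₁) (ih₂ h₂)
    | drop _ _ h => exact .drop _ _ (ih₂ h)
  | drop e c _ ih => exact .drop e c (ih h)

theorem ConnSub.trans_rootedSub {s t u : EdgeTree ε} (h : ConnSub s t) (h' : RootedSub t u) :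
    ConnSub s u := by
  induction h' generalizing s with
  | nil T =>
    cases h with
    | root h => cases h; exact .root (.nil _)
  | cons e h₁ h₂ ih₁ ih₂ =>
    cases h with
    | root h => exact .root (h.trans (.cons e h₁ h₂))
    | child _ _ h => exact .child _ _ (ih₁ h)
    | sib _ _ h => exact .sib _ _ (ih₂ h)
  | drop e c _ ih => exact .sib e c (ih h)

theorem ConnSub.trans {s t u : EdgeTree ε} (h : ConnSub s t) (h' : ConnSub t u) : ConnSub s u := by
  induction h' with
  | root h' => exact h.trans_rootedSub h'
  | child e r _ ih => exact .child e r (ih h)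
  | sib e c _ ih => exact .sib e c (ih h)

theorem RootedSub.edges_sublist {s t : EdgeTree ε} (h : RootedSub s t) :
    s.edges.Sublist t.edges := by
  induction h with
  | nil T => exact List.nil_sublist _
  | cons e _ _ ih₁ ih₂ => exact (ih₁.append ih₂).cons_cons e
  | drop e c _ ih => exact (ih.trans (List.sublist_append_right _ _)).cons e

theorem ConnSub.edges_sublist {s t : EdgeTree ε} (h : ConnSub s t) : s.edges.Sublist t.edges := by
  induction h with
  | root h => exact h.edges_sublist
  | child e r _ ih => exact (ih.trans (List.sublist_append_left _ _)).cons e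
  | sib e c _ ih => exact (ih.trans (List.sublist_append_right _ _)).cons e

theorem length_edges : ∀ T : EdgeTree ε, T.edges.length = T.size
  | .nil => rfl
  | .cons e c r => by simp [edges, size, length_edges c, length_edges r]

theorem RootedSub.size_le {s t : EdgeTree ε} (h : RootedSub s t) : s.size ≤ t.size := by
  simpa [length_edges] using h.edges_sublist.length_le

theorem exists_rootedSub_size (T : EdgeTree ε) (j : ℕ) (hj : j ≤ T.size) :
    ∃ S, RootedSub S T ∧ S.size = j := by
  induction T generalizing j with
  | nil => exact ⟨.nil, .nil _, by simp only [size] at *; omega⟩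
  | cons e c r ihc ihr =>
    simp only [size] at hj
    rcases Nat.lt_or_ge r.size j with h | h
    · obtain ⟨S, hS, hs⟩ := ihc (j - r.size - 1) (by omega)
      exact ⟨.cons e S r, .cons e hS (.refl r), by simp only [size]; omega⟩
    · obtain ⟨S, hS, hs⟩ := ihr j h
      exact ⟨S, .drop e c hS, hs⟩

section Count

variable (P : ε → Prop) [DecidablePred P]

theorem countP_edges : ∀ T : EdgeTree ε, T.edges.countP (fun e => decide (P e)) = T.count P
  | .nil => rfl
  | .cons e c r => by
    simp [edges, count, List.countP_cons, countP_edges c, countP_edges r]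

theorem RootedSub.count_le {s t : EdgeTree ε} (h : RootedSub s t) : s.count P ≤ t.count P := by
  simpa [countP_edges] using h.edges_sublist.countP_le (p := fun e => decide (P e))

theorem ConnSub.count_le {s t : EdgeTree ε} (h : ConnSub s t) : s.count P ≤ t.count P := by
  simpa [countP_edges] using h.edges_sublist.countP_le (p := fun e => decide (P e))

theorem count_le_size (T : EdgeTree ε) : T.count P ≤ T.size := by
  simpa [countP_edges, length_edges] using
    List.countP_le_length (p := fun e => decide (P e)) (l := T.edges)

theorem RootedSub.size_sub_count_le {s t : EdgeTree ε} (h : RootedSub s t) :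
    s.size + t.count P ≤ t.size + s.count P := by
  induction h with
  | nil T => simpa [size, count] using count_le_size P T
  | cons e _ _ ih₁ ih₂ => simp only [size, count]; omega
  | drop e c _ ih =>
    have := count_le_size P c
    simp only [size, count]; split_ifs <;> omega

theorem RootedSub.exists_extension {s t : EdgeTree ε} (h : RootedSub s t) (j : ℕ) (hj : s.size ≤ j)
    (hj' : j ≤ t.size) : ∃ u, RootedSub u t ∧ u.size = j ∧ s.count P ≤ u.count P := by
  induction h generalizing j with
  | nil T =>
    obtain ⟨u, hu, hs⟩ := exists_rootedSub_size T j hj'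
    exact ⟨u, hu, hs, by simp [count]⟩
  | @cons e c' c r' r h₁ h₂ ih₁ ih₂ =>
    simp only [size] at hj hj'
    have := h₂.size_le
    have := h₁.size_le
    rcases Nat.lt_or_ge j (c'.size + r.size + 1) with h | h
    · obtain ⟨u, hu, hs, hc⟩ := ih₂ (j - c'.size - 1) (by omega) (by omega)
      exact ⟨.cons e c' u, .cons e h₁ hu, by simp only [size]; omega,
        by simp only [count]; omega⟩
    · obtain ⟨u, hu, hs, hc⟩ := ih₁ (j - r.size - 1) (by omega) (by omega)
      have := h₂.count_le P
      exact ⟨.cons e u r, .cons e hu (.refl r), by simp only [size]; omega,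
        by simp only [count]; omega⟩
  | @drop e c s r h ih =>
    simp only [size] at hj'
    rcases Nat.lt_or_ge r.size j with h' | h'
    · obtain ⟨u, hu, hs⟩ := exists_rootedSub_size c (j - r.size - 1) (by omega)
      have := h.count_le P
      exact ⟨.cons e u r, .cons e hu (.refl r), by simp only [size]; omega,
        by simp only [count]; omega⟩
    · obtain ⟨u, hu, hs, hc⟩ := ih j hj h'
      exact ⟨u, .drop e c hu, hs, hc⟩

/-- A connected part of a tree grows to a connected part of any size up to that of the tree. Once
everything below the highest vertex is used up, the growth takes in the edge above it, so the
extension need not be a rooted part at the vertex where `s` was. -/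
theorem ConnSub.exists_extension {s t : EdgeTree ε} (h : ConnSub s t) (j : ℕ) (hj : s.size ≤ j)
    (hj' : j ≤ t.size) : ∃ u, ConnSub u t ∧ u.size = j ∧ s.count P ≤ u.count P := by
  induction h generalizing j with
  | root h =>
    obtain ⟨u, hu, hs⟩ := h.exists_extension P j hj hj'
    exact ⟨u, .root hu, hs⟩
  | @child e r s c h ih =>
    simp only [size] at hj'
    rcases Nat.lt_or_ge c.size j with h' | h'
    · obtain ⟨u, hu, hs⟩ := exists_rootedSub_size r (j - c.size - 1) (by omega)
      have := h.count_le P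
      exact ⟨.cons e c u, .root (.cons e (.refl c) hu), by simp only [size]; omega,
        by simp only [count]; omega⟩
    · obtain ⟨u, hu, hs, hc⟩ := ih j hj h'
      exact ⟨u, .child e r hu, hs, hc⟩
  | @sib e c s r h ih =>
    simp only [size] at hj'
    rcases Nat.lt_or_ge r.size j with h' | h'
    · obtain ⟨u, hu, hs⟩ := exists_rootedSub_size c (j - r.size - 1) (by omega)
      have := h.count_le P
      exact ⟨.cons e u r, .root (.cons e hu (.refl r)), by simp only [size]; omega,
        by simp only [count]; omega⟩
    · obtain ⟨u, hu, hs, hc⟩ := ih j hj h'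
      exact ⟨u, .sib e c hu, hs, hc⟩

/-! ### Pruning branches -/

/-- With `P` singling out the negative edges: every connected part with more than `a` negative edges
has at least `d` positive edges. Unlike local positivity, which says nothing about trees with fewer
than `k` edges, this passes to all connected parts. -/
def Sparse (a d : ℕ) (T : EdgeTree ε) : Prop :=
  ∀ S, ConnSub S T → a < S.count P → S.count P + d ≤ S.size

variable {P}

theorem Sparse.mono {a d : ℕ} {S T : EdgeTree ε} (h : T.Sparse P a d) (hS : ConnSub S T) :
    S.Sparse P a d := fun R hR => h R (hR.trans hS)

/-- A part violating sparseness could be shrunk or extended to `a + d` edges, keeping more than `a`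
negative ones. -/
theorem sparse_of_local {a d : ℕ} {T : EdgeTree ε} (hT : a + d ≤ T.size)
    (h : ∀ S, ConnSub S T → S.size = a + d → S.count P ≤ a) : T.Sparse P a d := by
  intro S hS hc
  by_contra hlt
  rcases Nat.lt_or_ge (a + d) S.size with h' | h'
  · obtain ⟨u, hu, hs⟩ := exists_rootedSub_size S (a + d) h'.le
    have h1 := h u ((ConnSub.root hu).trans hS) hs
    have h2 := hu.size_sub_count_le P
    omega
  · obtain ⟨u, hu, hs, hc'⟩ := hS.exists_extension P (a + d) h' hT
    have := h u hu hs
    omega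

/-- The pruning step. Give a positive edge the value `α` and a negative one `-β`. A sparse tree
either has at most `a` negative edges and negative value (unless it is empty), or it has a branch of
nonnegative value with at most `a` negative edges, whose removal leaves `S`. The two inequalities
say that fewer than `d` positive edges is what a tree of value at most `-1` with `a + 1` negative
edges, or of value at most `-2` with at most `2 * a` of them, must have. -/
theorem Sparse.reduce {a d α β : ℕ} (hβ : 0 < β) (h₁ : β * (a + 1) < α * d + 1)
    (h₂ : β * (2 * a) < α * d + 2) {T : EdgeTree ε} (hT : T.Sparse P a d) :
    (T.count P ≤ a ∧ (T = nil ∨ α * T.size < (α + β) * T.count P)) ∨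
    ∃ S, RootedSub S T ∧ S.size < T.size ∧ T.count P ≤ S.count P + a ∧
      (α * S.size : ℤ) - (α + β) * S.count P ≤ α * T.size - (α + β) * T.count P := by
  induction T with
  | nil => exact .inl ⟨by simp [count], .inl rfl⟩
  | cons e c r ihc ihr =>
    rcases ihc (hT.mono (.child e r (.root (.refl c)))) with ⟨hc, hc'⟩ | ⟨S, hS, hs, hn, hv⟩
    swap
    · right
      refine ⟨.cons e S r, .cons e hS (.refl r), by simp only [size]; omega,
        by simp only [count]; omega, ?_⟩
      simp only [size, count]; push_cast; linarith
    rcases ihr (hT.mono (.root (.drop e c (.refl r)))) with ⟨hr, hr'⟩ | ⟨S, hS, hs, hn, hv⟩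
    swap
    · right
      refine ⟨.cons e c S, .cons e (.refl c) hS, by simp only [size]; omega,
        by simp only [count]; omega, ?_⟩
      simp only [size, count]; push_cast; linarith
    -- The subtrees at `e` and beside it are irreducible; only the branch of `e` can be removed.
    set i : ℕ := if P e then 1 else 0 with hi
    have hi1 : i ≤ 1 := by rw [hi]; split_ifs <;> omega
    rcases Nat.lt_or_ge (α * (c.size + 1)) ((α + β) * (c.count P + i)) with hB | hB
    · -- The branch of `e` has negative value, so nothing can be removed; sparseness bounds the
      -- negative edges, for this branch alone and then for the whole tree.
      left
      have hBa : c.count P + i ≤ a := by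
        by_contra hlt
        have h3 := hT (.cons e c .nil) (.root (.cons e (.refl c) (.nil r)))
          (by simp only [count, ← hi]; omega)
        simp only [count, size, ← hi, add_zero] at h3
        have h4 : c.count P + i = a + 1 := by omega
        rw [h4] at h3 hB
        have h5 := Nat.mul_le_mul_left α h3
        nlinarith
      rcases hr' with rfl | hr'
      · simp only [count, size, ← hi, add_zero]
        exact ⟨hBa, .inr hB⟩
      · -- Each of the two parts has value at most `-1`, so together at most `-2`.
        simp only [count, size, ← hi]
        have hval : α * (c.size + r.size + 1) + 2 ≤
            (α + β) * (c.count P + r.count P + i) := by nlinarith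
        refine ⟨?_, .inr (by omega)⟩
        by_contra hlt
        have h3 := hT _ (.root (.refl _)) (by simp only [count, ← hi]; omega)
        simp only [count, size, ← hi] at h3
        have h5 := Nat.mul_le_mul_left α h3
        have h6 : β * (c.count P + r.count P + i) ≤ β * (2 * a) :=
          Nat.mul_le_mul_left β (by omega)
        nlinarith
    · right
      refine ⟨r, .drop e c (.refl r), by simp only [size]; omega, ?_, ?_⟩
      · simp only [count, ← hi]
        have : c.count P + i ≤ a := by
          rcases Nat.eq_zero_or_pos i with h0 | h0
          · omega
          · have h1 : i = 1 := by omega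
            rw [h1] at hB
            rcases hc' with rfl | hc'
            · simp only [count, size] at hB; omega
            · nlinarith
        omega
      · simp only [count, size, ← hi]
        zify at hB
        push_cast
        linarith

/-- Pruning with the values `2 * a` and `-d` shows that `a` negative edges cost at least `d / 2`
positive ones, up to a constant. -/
theorem Sparse.linear_bound {a d : ℕ} (ha : 1 ≤ a) (hd : 1 ≤ d) (T : EdgeTree ε)
    (hT : T.Sparse P a d) :
    ((2 * a + d : ℕ) : ℤ) * T.count P ≤ 2 * a * T.size + d * a := by
  induction hn : T.size using Nat.strong_induction_on generalizing T with
  | _ n ih =>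
    subst hn
    rcases hT.reduce (α := 2 * a) (β := d) hd (by nlinarith) (by nlinarith) with
      ⟨h, -⟩ | ⟨S, hS, hs, -, hv⟩
    · have h1 := count_le_size P T
      zify at h h1
      push_cast
      nlinarith
    · have := ih _ hs S (hT.mono (.root hS)) rfl
      push_cast at *
      linarith

/-- The weight of a sparse tree with more than `a` negative edges is at least `d - 2 * a`: prune
with the values `1` and `-1`, up to the last tree that still has more than `a` negative edges. That
tree has at most `2 * a` negative edges, and at least `d` positive ones. -/
theorem Sparse.sharp_bound {a d : ℕ} (had : a < d) (had' : 2 * a ≤ d + 1) (T : EdgeTree ε)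
    (hT : T.Sparse P a d) (ha : a < T.count P) : d + 2 * T.count P ≤ T.size + 2 * a := by
  induction hn : T.size using Nat.strong_induction_on generalizing T with
  | _ n ih =>
    subst hn
    rcases hT.reduce (α := 1) (β := 1) one_pos (by omega) (by omega) with
      ⟨h, -⟩ | ⟨S, hS, hs, hc, hv⟩
    · omega
    · by_cases h : a < S.count P
      · have := ih _ hs S (hT.mono (.root hS)) h rfl
        push_cast at hv
        omega
      · have := hT T (.root (.refl T)) ha
        omega

theorem sharp_bound_of_local {a d : ℕ} (had : a < d) (had' : 2 * a ≤ d + 1) {T : EdgeTree ε}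
    (hT : a + d ≤ T.size) (h : ∀ S, ConnSub S T → S.size = a + d → S.count P ≤ a) :
    d + 2 * T.count P ≤ T.size + 2 * a := by
  by_cases ha : a < T.count P
  · exact (sparse_of_local hT h).sharp_bound had had' T ha
  · omega

variable (P) in
/-- A large tree of bounded degree splits at an edge into `X` and `Y`, where `X` has between `k` and
`D * k` edges. Here `X'` and `Y'` are `X` and `Y` with that edge, and `i` tells whether it satisfies
`P`. -/
theorem exists_split (D k : ℕ) (T : EdgeTree ε) (hD : T.ChildDegLE D)
    (hT : T.deg * k < T.size) :
    ∃ X X' Y Y' : EdgeTree ε, ∃ i : ℕ, i ≤ 1 ∧ ConnSub X T ∧ ConnSub X' T ∧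
      RootedSub Y T ∧ RootedSub Y' T ∧ k ≤ X.size ∧ X.size ≤ D * k ∧ X'.size = X.size + 1 ∧
      X'.count P = X.count P + i ∧
      Y'.size = Y.size + 1 ∧ Y'.count P = Y.count P + i ∧
      T.size = X.size + Y.size + 1 ∧ T.count P = X.count P + Y.count P + i := by
  induction T with
  | nil => simp [size] at hT
  | cons e c r ihc ihr =>
    obtain ⟨hc, hDc, hDr⟩ := hD
    by_cases hr : r.deg * k < r.size
    · obtain ⟨X, X', Y, Y', i, hi, hX, hX', hY, hY', h1, h2, h3, h4, h5, h6, h7, h8⟩ := ihr hDr hr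
      refine ⟨X, X', .cons e c Y, .cons e c Y', i, hi, .sib e c hX, .sib e c hX',
        .cons e (.refl c) hY, .cons e (.refl c) hY', h1, h2, h3, h4, ?_⟩
      simp only [size, count]; omega
    · simp only [deg, size] at hT
      by_cases hck : c.size ≤ D * k
      · refine ⟨c, .cons e c .nil, r, .cons e .nil r, if P e then 1 else 0, by split_ifs <;> omega,
          .child e r (.root (.refl c)), .root (.cons e (.refl c) (.nil r)),
          .drop e c (.refl r), .cons e (.nil c) (.refl r), by nlinarith, hck, ?_⟩
        simp [size, count]
      · obtain ⟨X, X', Y, Y', i, hi, hX, hX', hY, hY', h1, h2, h3, h4, h5, h6, h7, h8⟩ :=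
          ihc hDc (lt_of_le_of_lt (Nat.mul_le_mul_right k hc) (not_le.1 hck))
        refine ⟨X, X', .cons e Y r, .cons e Y' r, i, hi, .child e r hX, .child e r hX',
          .cons e hY (.refl r), .cons e hY' (.refl r), h1, h2, h3, h4, ?_⟩
        simp only [size, count]; omega

/-- If all connected parts with at least `a + d` edges have nonnegative weight, then a large tree
has positive weight. Otherwise split it as `X`, an edge, and `Y`: for either sign of the edge, the
bounds for `X`, `Y` and for these parts with the edge added contradict each other. -/
theorem two_mul_count_lt_of_local {a d D : ℕ} (had : a < d) (had' : 2 * a ≤ d) {T : EdgeTree ε}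
    (hdeg : T.deg ≤ D) (hD : T.ChildDegLE D) (hT : (D + 1) * (a + d) < T.size)
    (h : ∀ S, ConnSub S T → S.size = a + d → S.count P ≤ a) :
    2 * T.count P < T.size := by
  have key : ∀ S, ConnSub S T → a + d ≤ S.size → 2 * S.count P ≤ S.size := by
    intro S hS hs
    have := sharp_bound_of_local had (by omega) hs fun R hR => h R (hR.trans hS)
    omega
  obtain ⟨X, X', Y, Y', i, hi, hX, hX', hY, hY', h1, h2, h3, h4, h5, h6, h7, h8⟩ :=
    exists_split P D (a + d) T hD
      (lt_of_le_of_lt (Nat.mul_le_mul_right _ hdeg) (by nlinarith))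
  have hYk : a + d ≤ Y.size := by nlinarith
  have := key X hX h1
  have := key X' hX' (by omega)
  have := key Y (.root hY) hYk
  have := key Y' (.root hY') (by omega)
  omega

variable (P) in
/-- A path is cut after its first `k` edges. -/
theorem exists_window (k : ℕ) (T : EdgeTree ε) (hdeg : T.deg ≤ 1) (hD : T.ChildDegLE 1)
    (hk : k ≤ T.size) : ∃ S R, RootedSub S T ∧ ConnSub R T ∧ R.deg ≤ 1 ∧ R.ChildDegLE 1 ∧
      S.size = k ∧ T.size = S.size + R.size ∧ T.count P = S.count P + R.count P := by
  induction k generalizing T with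
  | zero => exact ⟨.nil, T, .nil T, .root (.refl T), hdeg, hD, by simp [size, count]⟩
  | succ k ih =>
    match T, hdeg, hD, hk with
    | .cons e c .nil, _, ⟨hc, hDc, _⟩, hk =>
      simp only [size] at hk
      obtain ⟨S, R, hS, hR, h1, h2, h3, h4, h5⟩ := ih c hc hDc (by omega)
      refine ⟨.cons e S .nil, R, .cons e hS (.refl _), .child e _ hR, h1, h2, ?_⟩
      simp only [size, count]; omega

/-- Cutting a path into windows of `k` edges, its weight is at least its number of windows minus the
length of the rest. The inequality is `k` times this bound, with a generous constant. -/
theorem path_bound {k : ℕ} (hk : 1 ≤ k) (T : EdgeTree ε) (hdeg : T.deg ≤ 1) (hD : T.ChildDegLE 1)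
    (h : ∀ S, ConnSub S T → S.size = k → 2 * S.count P < k) :
    T.size + 2 * k * T.count P ≤ k * T.size + k * k + k := by
  induction hn : T.size using Nat.strong_induction_on generalizing T with
  | _ n ih =>
    subst hn
    by_cases hT : k ≤ T.size
    · obtain ⟨S, R, hS, hR, h1, h2, h3, h4, h5⟩ := exists_window P k T hdeg hD hT
      have := ih R.size (by omega) R h1 h2 (fun S hS => h S (hS.trans hR)) rfl
      have hS' := h S (.root hS) h3
      rw [h4, h5, h3]
      nlinarith
    · have := count_le_size P T
      nlinarith

theorem two_mul_count_lt_of_path {k : ℕ} (hk : 1 ≤ k) {T : EdgeTree ε} (hdeg : T.deg ≤ 2)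
    (hD : T.ChildDegLE 1) (h : ∀ S, ConnSub S T → S.size = k → 2 * S.count P < k)
    (hT : 2 * (k * k + k) < T.size) : 2 * T.count P < T.size := by
  match T, hdeg, hD with
  | .nil, _, _ => simp [size] at hT
  | .cons e c r, hdeg, ⟨hc, hDc, hDr⟩ =>
    simp only [deg] at hdeg
    have h1 := path_bound hk (.cons e c .nil) (by simp [deg]) ⟨hc, hDc, trivial⟩
      fun S hS => h S (hS.trans (.root (.cons e (.refl c) (.nil r))))
    have h2 := path_bound hk r (by omega) hDr fun S hS => h S (.sib e c hS)
    simp only [size, count] at *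
    by_contra hlt
    have := Nat.mul_le_mul_left k (not_lt.1 hlt)
    nlinarith

end Count
end EdgeTree

/-! ### Unfolding a connected graph into an edge tree -/

namespace EdgeTree

section Realization

variable {V : Type*} {G : SimpleGraph V}

/-- `Realizes G u T`: the edges of `T` are edges of `G`, with the root at `u`. Vertices may repeat:
an edge of a cycle of `G` can occur as a pendant edge of `T` whose far end lies elsewhere in `T`,
too. -/
inductive Realizes (G : SimpleGraph V) : V → EdgeTree (Sym2 V) → Prop
  | nil (u : V) : Realizes G u nil
  | cons {u x : V} {c r : EdgeTree (Sym2 V)} (h : G.Adj u x) (hc : Realizes G x c)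
      (hr : Realizes G u r) : Realizes G u (cons s(u, x) c r)

theorem Realizes.mem_edgeSet {u : V} {T : EdgeTree (Sym2 V)} (h : Realizes G u T) :
    ∀ e ∈ T.edges, e ∈ G.edgeSet := by
  induction h with
  | nil u => simp [edges]
  | cons h _ _ ihc ihr =>
    intro e he
    simp only [edges, List.mem_cons, List.mem_append] at he
    rcases he with rfl | he | he
    · exact h
    · exact ihc e he
    · exact ihr e he

theorem Realizes.rootedSub {u : V} {S T : EdgeTree (Sym2 V)} (h : Realizes G u T)
    (hS : RootedSub S T) :
    Realizes G u S := by
  induction hS generalizing u with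
  | nil T => exact .nil u
  | cons e _ _ ih₁ ih₂ =>
    cases h with
    | cons h hc hr => exact .cons h (ih₁ hc) (ih₂ hr)
  | drop e c _ ih =>
    cases h with
    | cons h hc hr => exact ih hr

theorem Realizes.connSub {u : V} {S T : EdgeTree (Sym2 V)} (h : Realizes G u T) (hS : ConnSub S T) :
    ∃ x, Realizes G x S := by
  induction hS generalizing u with
  | root hS => exact ⟨u, h.rootedSub hS⟩
  | child e r _ ih =>
    cases h with
    | cons h hc hr => exact ih hc
  | sib e c _ ih =>
    cases h with
    | cons h hc hr => exact ih hr

theorem Realizes.exists_subgraph {u : V} {T : EdgeTree (Sym2 V)} (h : Realizes G u T) :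
    ∃ H : G.Subgraph, H.Connected ∧ u ∈ H.verts ∧ H.edgeSet = {e | e ∈ T.edges} := by
  induction h with
  | nil u =>
    exact ⟨G.singletonSubgraph u, SimpleGraph.Subgraph.singletonSubgraph_connected, by simp,
      by simp [edges]⟩
  | @cons u x c r h _ _ ihc ihr =>
    obtain ⟨Hc, hc, hxc, hec⟩ := ihc
    obtain ⟨Hr, hr, hur, her⟩ := ihr
    have h1 : (G.subgraphOfAdj h ⊔ Hc).Connected :=
      SimpleGraph.Subgraph.connected_sup
        (SimpleGraph.Subgraph.subgraphOfAdj_connected h).preconnected hc.preconnected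
        ⟨x, by simp, hxc⟩
    refine ⟨G.subgraphOfAdj h ⊔ Hc ⊔ Hr, SimpleGraph.Subgraph.connected_sup
      h1.preconnected hr.preconnected ⟨u, by simp, hur⟩, by simp, ?_⟩
    ext e
    simp [hec, her, edges, or_assoc]

/-- A further edge can be attached to every vertex of a realized tree. -/
theorem Realizes.exists_insert {u : V} {T : EdgeTree (Sym2 V)} (h : Realizes G u T) {v y : V}
    (hv : v = u ∨ ∃ e ∈ T.edges, v ∈ e) (hvy : G.Adj v y) :
    ∃ T', Realizes G u T' ∧ T'.edges.Perm (s(v, y) :: T.edges) := by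
  induction h with
  | nil u =>
    obtain rfl : v = u := by simpa [edges] using hv
    exact ⟨_, .cons hvy (.nil y) (.nil v), by simp [edges]⟩
  | @cons u x c r h hc hr ihc ihr =>
    by_cases hvu : v = u
    · subst hvu
      exact ⟨_, .cons hvy (.nil y) (.cons h hc hr), by simp [edges]⟩
    have hv' : (v = x ∨ ∃ e ∈ c.edges, v ∈ e) ∨ ∃ e ∈ r.edges, v ∈ e := by
      obtain ⟨e, he, hve⟩ := hv.resolve_left hvu
      simp only [edges, List.mem_cons, List.mem_append] at he
      rcases he with rfl | he | he
      · exact .inl (.inl ((Sym2.mem_iff.1 hve).resolve_left hvu))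
      · exact .inl (.inr ⟨e, he, hve⟩)
      · exact .inr ⟨e, he, hve⟩
    rcases hv' with hv' | hv'
    · obtain ⟨T', hT', hp⟩ := ihc hv'
      refine ⟨_, .cons h hT' hr, ?_⟩
      simp only [edges]
      exact ((hp.append_right r.edges).cons _).trans (.swap _ _ _)
    · obtain ⟨T', hT', hp⟩ := ihr (.inr hv')
      refine ⟨_, .cons h hc hT', ?_⟩
      simp only [edges]
      exact (((hp.append_left c.edges).trans List.perm_middle).cons _).trans (.swap _ _ _)

/-- Every finite connected graph unfolds into an edge tree containing each of its edges exactly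
once. -/
theorem exists_realizes [Finite V] (hG : G.Connected) (u : V) :
    ∃ T, Realizes G u T ∧ T.edges.Nodup ∧ ∀ e, e ∈ T.edges ↔ e ∈ G.edgeSet := by
  classical
  have key : ∀ n : ℕ, ∃ T, Realizes G u T ∧ T.edges.Nodup ∧
      (T.edges.length = n ∨ ∀ e ∈ G.edgeSet, e ∈ T.edges) := by
    intro n
    induction n with
    | zero => exact ⟨nil, .nil u, by simp [edges], .inl rfl⟩
    | succ n ih =>
      obtain ⟨T, hT, hnd, hlen | hall⟩ := ih
      swap
      · exact ⟨T, hT, hnd, .inr hall⟩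
      by_cases hex : ∃ v y, (v = u ∨ ∃ e ∈ T.edges, v ∈ e) ∧ G.Adj v y ∧ s(v, y) ∉ T.edges
      · obtain ⟨v, y, hv, hvy, hnot⟩ := hex
        obtain ⟨T', hT', hp⟩ := hT.exists_insert hv hvy
        exact ⟨T', hT', hp.nodup_iff.2 (List.nodup_cons.2 ⟨hnot, hnd⟩),
          .inl (by rw [hp.length_eq, List.length_cons, hlen])⟩
      · -- The vertex set of `T` is closed under adjacency, so it is everything.
        push Not at hex
        have hW : ∀ v, v = u ∨ ∃ e ∈ T.edges, v ∈ e := by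
          intro v
          have hp : ∀ {v b : V} (_ : G.Walk v b), (b = u ∨ ∃ e ∈ T.edges, b ∈ e) →
              v = u ∨ ∃ e ∈ T.edges, v ∈ e := by
            intro v b q
            induction q with
            | nil => exact id
            | @cons a b _ hab _ ih =>
              exact fun h => .inr ⟨s(b, a), hex b a (ih h) hab.symm, Sym2.mem_mk_right b a⟩
          obtain ⟨p⟩ := hG.preconnected v u
          exact hp p (.inl rfl)
        refine ⟨T, hT, hnd, .inr fun e he => ?_⟩
        induction e with
        | _ p q => exact hex p q (hW p) he
  obtain ⟨T, hT, hnd, h⟩ := key (G.edgeSet.ncard + 1)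
  refine ⟨T, hT, hnd, fun e => ⟨hT.mem_edgeSet e, ?_⟩⟩
  rcases h with h | h
  · have h1 : ((T.edges.toFinset : Finset (Sym2 V)) : Set (Sym2 V)) ⊆ G.edgeSet := by
      intro e he
      exact hT.mem_edgeSet e (by simpa using he)
    have h2 := Set.ncard_le_ncard h1 (Set.toFinite _)
    rw [Set.ncard_coe_finset, List.toFinset_card_of_nodup hnd] at h2
    omega
  · exact h e

/-- The branches at the root are distinct edges at `u`; `s` is any set containing these edges. -/
theorem Realizes.deg_le [Fintype V] {u : V} {T : EdgeTree (Sym2 V)} (h : Realizes G u T)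
    (hnd : T.edges.Nodup) {s : Finset (Sym2 V)}
    (hs : ∀ e ∈ G.edgeSet, u ∈ e → e ∈ T.edges → e ∈ s) :
    T.deg ≤ s.card := by
  classical
  induction h generalizing s with
  | nil u => simp [deg]
  | @cons u x c r h _ _ _ ihr =>
    simp only [edges, List.nodup_cons, List.mem_append, not_or] at hnd
    have h1 := ihr (List.Nodup.of_append_right hnd.2) (s := s.erase s(u, x)) fun e he hu her => by
      refine Finset.mem_erase.2 ⟨?_, hs e he hu (by simp [edges, her])⟩
      rintro rfl
      exact hnd.1.2 her
    have h2 : s(u, x) ∈ s := hs _ h (by simp) (by simp [edges])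
    have := Finset.card_erase_add_one h2
    simp only [deg]
    omega

theorem Realizes.childDegLE [Fintype V] [DecidableRel G.Adj] {Δ : ℕ}
    (hΔ : G.maxDegree ≤ Δ + 1) {u : V} {T : EdgeTree (Sym2 V)} (h : Realizes G u T)
    (hnd : T.edges.Nodup) : T.ChildDegLE Δ := by
  classical
  induction h with
  | nil u => trivial
  | @cons u x c r h hc _ ihc ihr =>
    simp only [edges, List.nodup_cons, List.mem_append, not_or] at hnd
    have hndc := List.Nodup.of_append_left hnd.2
    refine ⟨?_, ihc hndc, ihr (List.Nodup.of_append_right hnd.2)⟩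
    have hmem : s(u, x) ∈ G.incidenceFinset x := by
      rw [SimpleGraph.mem_incidenceFinset]
      exact ⟨h, Sym2.mem_mk_right u x⟩
    have h1 := hc.deg_le hndc (s := (G.incidenceFinset x).erase s(u, x)) fun e he hx hec => by
      refine Finset.mem_erase.2 ⟨?_, by simpa [SimpleGraph.incidenceSet] using ⟨he, hx⟩⟩
      rintro rfl
      exact hnd.1.1 hec
    have h2 := Finset.card_erase_add_one hmem
    rw [G.card_incidenceFinset_eq_degree] at h2
    have := G.degree_le_maxDegree x
    omega

end Realization
end EdgeTree

namespace FinGraph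

theorem weight_eq {G : FinGraph} {w : Sym2 G.V → ℤ} {T : EdgeTree (Sym2 G.V)}
    (hnd : T.edges.Nodup) (hw : ∀ e ∈ T.edges, w e = -1 ∨ w e = 1) :
    weight w {e | e ∈ T.edges} = T.size - 2 * T.count (fun e => w e = -1) := by
  classical
  have h1 : weight w {e | e ∈ T.edges} = ∑ e ∈ T.edges.toFinset, w e :=
    Finset.sum_congr (by ext e; simp) fun _ _ => rfl
  rw [h1, List.sum_toFinset w hnd, ← EdgeTree.length_edges, ← EdgeTree.countP_edges]
  generalize T.edges = l at hw
  clear hnd h1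
  induction l with
  | nil => simp
  | cons e l ih =>
    have h2 := ih fun e he => hw e (by simp [he])
    rw [List.map_cons, List.sum_cons, h2, List.countP_cons, List.length_cons]
    rcases hw e (by simp) with h | h <;> simp [h] <;> ring

/-- The lower bounds need no more of a graph than this tree: connected parts of the tree are
connected subgraphs of the graph. -/
theorem exists_edgeTree {G : FinGraph} {k Δ : ℕ} {w : Sym2 G.V → ℤ} (hG : G.graph.Connected)
    (hΔ : G.MaxDegreeLE (Δ + 1)) (hw : G.IsLocalPositive k w) :
    ∃ T : EdgeTree (Sym2 G.V), T.size = G.numEdges ∧ T.deg ≤ Δ + 1 ∧ T.ChildDegLE Δ ∧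
      G.totalWeight w = T.size - 2 * T.count (fun e => w e = -1) ∧
      ∀ S, EdgeTree.ConnSub S T → S.size = k → 2 * S.count (fun e => w e = -1) < k := by
  classical
  obtain ⟨u⟩ := hG.nonempty
  obtain ⟨T, hT, hnd, hmem⟩ := EdgeTree.exists_realizes hG u
  have hset : G.graph.edgeSet = {e | e ∈ T.edges} := by ext e; simp [hmem]
  have hdeg := hT.deg_le hnd (s := G.graph.incidenceFinset u) fun e he hu _ => by
    simpa [SimpleGraph.incidenceSet] using ⟨he, hu⟩
  rw [G.graph.card_incidenceFinset_eq_degree] at hdeg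
  have hΔ' : G.graph.maxDegree ≤ Δ + 1 := by
    unfold MaxDegreeLE at hΔ; convert hΔ
  refine ⟨T, ?_, (hdeg.trans (G.graph.degree_le_maxDegree u)).trans hΔ', hT.childDegLE hΔ' hnd,
    ?_, ?_⟩
  · rw [numEdges, hset, ← List.coe_toFinset, Set.ncard_coe_finset,
      List.toFinset_card_of_nodup hnd, EdgeTree.length_edges]
  · rw [totalWeight, hset]
    exact weight_eq hnd fun e he => hw.1 e ((hmem e).1 he)
  · intro S hS hk
    have hSnd := hnd.sublist hS.edges_sublist
    obtain ⟨x, hx⟩ := hT.connSub hS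
    obtain ⟨H, hH, -, hHe⟩ := hx.exists_subgraph
    have h1 := hw.2 H hH (by
      rw [hHe, ← List.coe_toFinset, Set.ncard_coe_finset,
        List.toFinset_card_of_nodup hSnd, EdgeTree.length_edges, hk])
    rw [hHe, weight_eq hSnd fun e he => hw.1 e (hx.mem_edgeSet e he)] at h1
    omega

end FinGraph

/-! ### Lower bounds for the total weight -/

theorem finite_numEdges_le (M : ℕ) {𝒢 : Set FinGraph} (h𝒢 : ∀ G ∈ 𝒢, G.graph.Connected) :
    {G ∈ 𝒢 | G.numEdges ≤ M}.Finite := by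
  have h1 : (Set.univ : Set ((n : Fin (M + 2)) × SimpleGraph (Fin n))).Finite := Set.toFinite _
  refine (h1.image fun G => (⟨G.1, G.2⟩ : FinGraph)).subset ?_
  rintro ⟨n, G⟩ ⟨hG, hM⟩
  have h2 : Nat.card (Fin n) ≤ Nat.card G.edgeSet + 1 :=
    (h𝒢 _ hG).card_vert_le_card_edgeSet_add_one
  have h3 : Nat.card G.edgeSet ≤ M := hM
  simp only [Nat.card_eq_fintype_card, Fintype.card_fin] at h2 h3
  exact ⟨⟨⟨n, by omega⟩, G⟩, trivial, rfl⟩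

theorem forAlmostAll_of_numEdges (M : ℕ) {𝒢 : Set FinGraph} (h𝒢 : ∀ G ∈ 𝒢, G.graph.Connected)
    {P : FinGraph → Prop} (h : ∀ G ∈ 𝒢, M < G.numEdges → P G) : ForAlmostAll 𝒢 P :=
  (finite_numEdges_le M h𝒢).subset fun G hG => ⟨hG.1, not_lt.1 fun hM => hG.2 (h G hG.1 hM)⟩

/-- A large graph splits into two large parts with nonnegative weight. Here and below, `a` is the
largest number of negative edges that a connected subgraph with `k = a + d` edges and positive
weight can have. -/
theorem forcing_of_two_mul_le {a d k Δ : ℕ} (hk : k = a + d) (hka : k ≤ 2 * a + 2) (had : a < d)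
    (had' : 2 * a ≤ d) {𝒢 : Set FinGraph} (h𝒢 : 𝒢 ⊆ connectedGraphs (Δ + 1)) : Forcing 𝒢 k := by
  refine forAlmostAll_of_numEdges ((Δ + 2) * (a + d)) (fun G hG => (h𝒢 hG).1)
    fun G hG hM w hw => ?_
  obtain ⟨T, hT, hdeg, hD, hwT, hloc⟩ := FinGraph.exists_edgeTree (h𝒢 hG).1 (h𝒢 hG).2 hw
  have := EdgeTree.two_mul_count_lt_of_local (P := fun e => w e = -1) (D := Δ + 1) had had' hdeg
    (hD.mono (Nat.le_succ Δ)) (by rw [hT]; exact hM) fun S hS hs => by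
      have := hloc S hS (by omega)
      omega
  omega

theorem forcing_of_path {k : ℕ} (hk : 1 ≤ k) {𝒢 : Set FinGraph} (h𝒢 : 𝒢 ⊆ connectedGraphs 2) :
    Forcing 𝒢 k := by
  refine forAlmostAll_of_numEdges (2 * (k * k + k)) (fun G hG => (h𝒢 hG).1)
    fun G hG hM w hw => ?_
  obtain ⟨T, hT, hdeg, hD, hwT, hloc⟩ := FinGraph.exists_edgeTree (h𝒢 hG).1 (h𝒢 hG).2 hw
  have := EdgeTree.two_mul_count_lt_of_path hk hdeg hD hloc (by omega)
  omega

theorem forAlmostAll_neg_one_le {a d k Δ : ℕ} (hk : k = a + d) (hka : k ≤ 2 * a + 2)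
    (had : a < d) (had' : 2 * a ≤ d + 1) {𝒢 : Set FinGraph} (h𝒢 : 𝒢 ⊆ connectedGraphs (Δ + 1)) :
    ForAlmostAll 𝒢 fun G => ∀ w, G.IsLocalPositive k w → -1 ≤ (G.totalWeight w : ℝ) := by
  refine forAlmostAll_of_numEdges (a + d) (fun G hG => (h𝒢 hG).1) fun G hG hM w hw => ?_
  obtain ⟨T, hT, hdeg, hD, hwT, hloc⟩ := FinGraph.exists_edgeTree (h𝒢 hG).1 (h𝒢 hG).2 hw
  have := EdgeTree.sharp_bound_of_local (P := fun e => w e = -1) had had'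
    (T := T) (by omega) fun S hS hs => by
      have := hloc S hS (by omega)
      omega
  have h2 : -1 ≤ G.totalWeight w := by omega
  exact_mod_cast h2

theorem mem_collapseRates {a d k Δ : ℕ} (hk : k = a + d) (hka : k ≤ 2 * a + 2) (ha : 1 ≤ a)
    (hd : 1 ≤ d) (had : d ≤ 2 * a) {𝒢 : Set FinGraph} (h𝒢 : 𝒢 ⊆ connectedGraphs (Δ + 1)) :
    -((2 * a - d : ℝ) / (2 * a + d)) ∈ collapseRates 𝒢 k := by
  have had' : (d : ℝ) ≤ 2 * a := by exact_mod_cast had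
  have hpos : (0 : ℝ) < 2 * a + d := by
    have : (1 : ℝ) ≤ d := by exact_mod_cast hd
    positivity
  refine ⟨neg_nonpos.2 (div_nonneg (by linarith) hpos.le), fun _ => (k + 2 * d * a : ℝ), ?_, ?_⟩
  · rw [isLittleO_const_left]
    exact .inr (tendsto_norm_atTop_atTop.comp tendsto_natCast_atTop_atTop)
  intro G hG w hw
  obtain ⟨T, hT, hdeg, hD, hwT, hloc⟩ := FinGraph.exists_edgeTree (h𝒢 hG).1 (h𝒢 hG).2 hw
  have hcs := EdgeTree.count_le_size (fun e => w e = -1) T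
  have hwT' : (G.totalWeight w : ℝ) = T.size - 2 * T.count (fun e => w e = -1) := by
    rw [hwT]; push_cast; rfl
  rw [hwT', ← hT]
  rw [← neg_div, div_mul_eq_mul_div, sub_le_iff_le_add, div_le_iff₀ hpos]
  rcases Nat.lt_or_ge T.size k with hs | hs
  · have hcs' : (T.count (fun e => w e = -1) : ℝ) ≤ T.size := by exact_mod_cast hcs
    have hs' : (T.size : ℝ) ≤ k := by exact_mod_cast hs.le
    have h0 : (0 : ℝ) ≤ T.size := by positivity
    have h3 : (0 : ℝ) ≤ d * a := by positivity
    nlinarith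
  · have h1 := (EdgeTree.sparse_of_local (P := fun e => w e = -1) (a := a) (d := d) (T := T)
      (by omega) fun S hS hs => by
        have := hloc S hS (by omega)
        omega).linear_bound ha hd
    have h2 : ((2 * a + d : ℕ) : ℝ) * T.count (fun e => w e = -1) ≤ 2 * a * T.size + d * a := by
      exact_mod_cast h1
    push_cast at h2
    have h3 : (0 : ℝ) ≤ d * a := by positivity
    have h4 : (1 : ℝ) ≤ 2 * a + d := by
      have : 1 ≤ 2 * a + d := by omega
      exact_mod_cast this
    have h5 : (0 : ℝ) ≤ k := by positivity
    nlinarith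

/-! ### Trees given by a parent function -/

/-- If `φ` changes by at most one along edges, and only along edges in `P`, then a connected
subgraph that meets the levels `0` and at least `d` has at least `d` edges in `P`: one for each step
between consecutive levels. -/
theorem SimpleGraph.Subgraph.Connected.le_ncard_of_lipschitz {V : Type*} [Finite V]
    {G : SimpleGraph V} {H : G.Subgraph} (hH : H.Connected) (φ : V → ℕ) (P : Set (Sym2 V))
    (hφ : ∀ x y, H.Adj x y → φ x < φ y → φ y = φ x + 1 ∧ s(x, y) ∈ P) {u v : V} {d : ℕ}
    (hu : u ∈ H.verts) (hv : v ∈ H.verts) (hu0 : φ u = 0) (hvd : d ≤ φ v) :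
    d ≤ (H.edgeSet ∩ P).ncard := by
  have key : ∀ t : Fin d, ∃ x y, H.Adj x y ∧ φ x = t ∧ φ y = t + 1 := by
    intro t
    obtain ⟨p⟩ := hH.preconnected ⟨u, hu⟩ ⟨v, hv⟩
    obtain ⟨e, -, h1, h2⟩ := p.exists_boundary_dart {x | φ x ≤ t} (by simp [hu0])
      (by simp only [Set.mem_ofPred_eq]; omega)
    simp only [Set.mem_ofPred_eq, not_le] at h1 h2
    have h3 : H.Adj e.fst e.snd := e.adj
    have h4 := (hφ _ _ h3 (by omega)).1
    exact ⟨_, _, h3, by omega, by omega⟩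
  choose x y hxy hx hy using key
  have hinj : Function.Injective fun t : Fin d => s(x t, y t) := by
    intro s t hst
    have h1 := hx s
    have h2 := hx t
    have h3 := hy s
    have h4 := hy t
    rcases Sym2.eq_iff.1 hst with ⟨h, h'⟩ | ⟨h, h'⟩ <;> rw [h] at h1 <;> rw [h'] at h3 <;>
      exact Fin.ext (by omega)
  have hsub : Set.range (fun t : Fin d => s(x t, y t)) ⊆ H.edgeSet ∩ P := by
    rintro _ ⟨t, rfl⟩
    exact ⟨hxy t, (hφ _ _ (hxy t) (by rw [hx, hy]; omega)).2⟩
  have h := Set.ncard_le_ncard hsub (Set.toFinite _)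
  rwa [← Set.image_univ, Set.ncard_image_of_injective _ hinj, Set.ncard_univ,
    Nat.card_eq_fintype_card, Fintype.card_fin] at h

section ParentGraph

/-- The graph on `0, …, L` joining each `v > 0` to `p v`. Only pairs with `p v < v` are joined,
which holds for all `v > 0` in the uses below. -/
def parentGraph (L : ℕ) (p : ℕ → ℕ) : SimpleGraph (Fin (L + 1)) where
  Adj u v := (v.1 < u.1 ∧ p u.1 = v.1) ∨ (u.1 < v.1 ∧ p v.1 = u.1)
  symm := ⟨fun _ _ h => h.symm⟩
  loopless := ⟨fun _ h => by omega⟩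

variable {L : ℕ} {p : ℕ → ℕ}

/-- The edge from `v + 1` to its parent. -/
def childEdge (hp : ∀ v, 0 < v → p v < v) (v : Fin L) : Sym2 (Fin (L + 1)) :=
  s(v.succ, ⟨p (v + 1), by have := hp (v + 1) (by omega); omega⟩)

theorem childEdge_injective (hp : ∀ v, 0 < v → p v < v) :
    Function.Injective (childEdge hp (L := L)) := by
  intro u v h
  have h1 := hp (u + 1) (by omega)
  have h2 := hp (v + 1) (by omega)
  rcases Sym2.eq_iff.1 h with ⟨h, h'⟩ | ⟨h, h'⟩ <;>
    simp only [Fin.ext_iff, Fin.val_succ] at h h' <;> exact Fin.ext (by omega)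

theorem edgeSet_parentGraph (hp : ∀ v, 0 < v → p v < v) :
    (parentGraph L p).edgeSet = Set.range (childEdge hp (L := L)) := by
  have key : ∀ u v : Fin (L + 1), v.1 < u.1 → p u.1 = v.1 →
      s(u, v) ∈ Set.range (childEdge hp (L := L)) := by
    intro u v h h'
    refine ⟨⟨u.1 - 1, by omega⟩, ?_⟩
    have hu : u.1 - 1 + 1 = u.1 := by omega
    rw [childEdge, Sym2.eq_iff]
    left
    simp only [Fin.ext_iff, Fin.val_succ, hu]
    exact ⟨trivial, h'⟩
  ext e
  constructor
  · induction e with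
    | _ u v =>
      rintro (⟨h, h'⟩ | ⟨h, h'⟩)
      · exact key u v h h'
      · rw [Sym2.eq_swap]; exact key v u h h'
  · rintro ⟨v, rfl⟩
    exact .inl ⟨by simpa using hp (v + 1) (by omega), by simp⟩

theorem ncard_edgeSet_parentGraph (hp : ∀ v, 0 < v → p v < v) :
    (parentGraph L p).edgeSet.ncard = L := by
  rw [edgeSet_parentGraph hp, ← Set.image_univ,
    Set.ncard_image_of_injective _ (childEdge_injective hp), Set.ncard_univ,
    Nat.card_eq_fintype_card, Fintype.card_fin]

theorem parentGraph_isTree (hp : ∀ v, 0 < v → p v < v) : (parentGraph L p).IsTree := by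
  rw [SimpleGraph.isTree_iff_connected_and_card]
  constructor
  · rw [SimpleGraph.connected_iff_exists_forall_reachable]
    refine ⟨0, fun ⟨v, hv⟩ => ?_⟩
    induction v using Nat.strong_induction_on with
    | _ v ih =>
      rcases Nat.eq_zero_or_pos v with rfl | h0
      · exact .refl _
      · have h1 := hp v h0
        refine (ih (p v) h1 (by omega)).trans (SimpleGraph.Adj.reachable ?_)
        exact .inr ⟨h1, rfl⟩
  · have := ncard_edgeSet_parentGraph hp (L := L)
    rw [← Nat.card_coe_set_eq] at this
    simp [this]

/-- The degree is at most three if every `u` has no other children than `u + 1` and `q u`. -/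
theorem parentGraph_maxDegree_le [DecidableRel (parentGraph L p).Adj] {q : ℕ → ℕ}
    (hq : ∀ v, 0 < v → v = p v + 1 ∨ v = q (p v)) : (parentGraph L p).maxDegree ≤ 3 := by
  refine SimpleGraph.maxDegree_le_of_forall_degree_le _ _ fun u => ?_
  rw [← SimpleGraph.card_neighborFinset_eq_degree,
    ← Finset.card_map (Fin.valEmbedding : Fin (L + 1) ↪ ℕ)]
  refine (Finset.card_le_card (t := {p u.1, u.1 + 1, q u.1}) ?_).trans Finset.card_le_three
  intro x hx
  simp only [Finset.mem_map, SimpleGraph.mem_neighborFinset] at hx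
  obtain ⟨v, hv, rfl⟩ := hx
  simp only [Fin.valEmbedding_apply, Finset.mem_insert, Finset.mem_singleton]
  rcases hv with ⟨_, h⟩ | ⟨h, h'⟩
  · exact .inl h.symm
  · rcases hq v (by omega) with h1 | h1 <;> rw [h'] at h1
    · exact .inr (.inl h1)
    · exact .inr (.inr h1)

/-- The weighing that is `-1` on the edges whose two ends have the same height. -/
def levelWeight {V : Type*} (h : V → ℕ) (e : Sym2 V) : ℤ :=
  open Classical in if (e.map h).IsDiag then -1 else 1

theorem levelWeight_mk {V : Type*} (h : V → ℕ) (x y : V) :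
    levelWeight h s(x, y) = if h x = h y then -1 else 1 := by
  simp [levelWeight]

theorem levelWeight_eq {V : Type*} (h : V → ℕ) (e : Sym2 V) :
    levelWeight h e = -1 ∨ levelWeight h e = 1 := by
  rw [levelWeight]
  split_ifs <;> simp

theorem totalWeight_parentGraph (hp : ∀ v, 0 < v → p v < v) (w : Sym2 (Fin (L + 1)) → ℤ) :
    FinGraph.totalWeight ⟨L + 1, parentGraph L p⟩ w = ∑ v : Fin L, w (childEdge hp v) := by
  classical
  have h1 : FinGraph.totalWeight ⟨L + 1, parentGraph L p⟩ w =
      ∑ e ∈ Finset.univ.image (childEdge hp (L := L)), w e := by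
    unfold FinGraph.totalWeight FinGraph.weight
    refine Finset.sum_congr ?_ fun _ _ => rfl
    ext e
    have := Set.ext_iff.1 (edgeSet_parentGraph hp (L := L)) e
    simpa using this
  rw [h1, Finset.sum_image fun _ _ _ _ h => childEdge_injective hp h]

end ParentGraph

theorem FinGraph.weight_eq_ncard {G : FinGraph} (w : Sym2 G.V → ℤ) (S : Set (Sym2 G.V))
    (hw : ∀ e ∈ S, w e = -1 ∨ w e = 1) :
    weight w S = S.ncard - 2 * (S ∩ {e | w e = -1}).ncard := by
  classical
  have h1 : weight w S = ∑ e ∈ S.toFinset, w e :=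
    Finset.sum_congr (by ext e; simp) fun _ _ => rfl
  have h2 : (S ∩ {e | w e = -1}).ncard = (S.toFinset.filter fun e => w e = -1).card := by
    rw [Set.ncard_eq_toFinset_card']
    congr 1
    ext e
    simp
  rw [h1, h2, Set.ncard_eq_toFinset_card', Finset.card_filter, Finset.card_eq_sum_ones]
  push_cast
  rw [Finset.mul_sum, ← Finset.sum_sub_distrib]
  refine Finset.sum_congr rfl fun e he => ?_
  rcases hw e (by simpa using he) with h | h <;> simp [h]

/-! ### Comb trees -/

section Comb

/-- The parent function of the comb. Its vertices come in blocks of `M`. In each block, vertex `0`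
has two paths attached, `0, 1, …, R` and `0, R + 1, …, M - 1`; vertex `0` of a block is joined to
vertex `1` of the block before. -/
def combParent (M R v : ℕ) : ℕ :=
  if v % M = 0 then v - M + 1 else if v % M = R + 1 then v - (R + 1) else v - 1

/-- The height of a vertex in the comb: along the path formed by a block it is `0` on the left end,
then increases by one along `d` edges, and stays `d` up to the right end. Vertex `0` of the block
has height `l`, and vertex `1` has height `l + 1`. The edges that keep the height are the negative
ones, so that each end of a block is a negative path. -/
def combHeight (M R d l v : ℕ) : ℕ :=
  if v % M ≤ R then min (l + v % M) d else l - (v % M - R)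

variable {M R : ℕ}

theorem combParent_lt (hM : 2 ≤ M) (v : ℕ) (hv : 0 < v) : combParent M R v < v := by
  unfold combParent
  have := Nat.mod_le v M
  split_ifs with h
  · have := Nat.le_of_dvd hv (Nat.dvd_of_mod_eq_zero h)
    omega
  all_goals omega

theorem combParent_cases (hM : 2 ≤ M) (hR : 1 ≤ R) {v : ℕ} (hv : 0 < v) :
    (v % M = 0 ∧ combParent M R v % M = 1 ∧ combParent M R v / M + 1 = v / M) ∨
    (v % M = R + 1 ∧ combParent M R v % M = 0 ∧ combParent M R v / M = v / M) ∨
    (v % M ≠ 0 ∧ v % M ≠ R + 1 ∧ combParent M R v % M + 1 = v % M ∧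
      combParent M R v / M = v / M) := by
  have hdiv := Nat.div_add_mod v M
  have hlt := Nat.mod_lt v (show M > 0 by omega)
  have key : ∀ i j, j < M → combParent M R v = M * i + j →
      combParent M R v % M = j ∧ combParent M R v / M = i := by
    intro i j hj h
    rw [h, Nat.mul_add_mod, Nat.mod_eq_of_lt hj, Nat.mul_add_div (by omega),
      Nat.div_eq_of_lt hj]
    exact ⟨rfl, rfl⟩
  by_cases h0 : v % M = 0
  · left
    obtain ⟨i, hi⟩ : ∃ i, v / M = i + 1 := by
      refine Nat.exists_eq_add_of_le' (Nat.one_le_iff_ne_zero.2 fun h => ?_)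
      rw [h, h0] at hdiv
      omega
    have h2 := key i 1 (by omega) (by
      rw [combParent, if_pos h0]
      rw [hi, h0, Nat.mul_add] at hdiv
      omega)
    exact ⟨h0, h2.1, by rw [h2.2, hi]⟩
  by_cases h1 : v % M = R + 1
  · right; left
    have h2 := key (v / M) 0 (by omega) (by rw [combParent, if_neg h0, if_pos h1]; omega)
    exact ⟨h1, h2⟩
  · right; right
    have h2 := key (v / M) (v % M - 1) (by omega) (by
      rw [combParent, if_neg h0, if_neg h1]; omega)
    exact ⟨h0, h1, by omega, h2.2⟩

/-- The children of a vertex: vertex `0` of a block branches to `R + 1`, and vertex `1` to the next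
block. -/
theorem combParent_branching (hM : 2 ≤ M) (hR : 1 ≤ R) (v : ℕ) (hv : 0 < v) :
    v = combParent M R v + 1 ∨ v = if combParent M R v % M = 0 then
      combParent M R v + (R + 1) else combParent M R v + M - 1 := by
  have hlt := Nat.mod_le v M
  rcases combParent_cases hM hR hv with ⟨h, h1, -⟩ | ⟨h, h1, -⟩ | ⟨h, h', -⟩
  · right
    have hle := Nat.le_of_dvd hv (Nat.dvd_of_mod_eq_zero h)
    simp only [h1, one_ne_zero, if_false]
    rw [combParent, if_pos h]
    omega
  · right
    simp only [h1, if_true]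
    rw [combParent, if_neg (by omega), if_pos h]
    omega
  · left
    rw [combParent, if_neg h, if_neg h']
    omega

variable {a d l : ℕ}

theorem combHeight_eq_iff (hl : l < d) (hM : M = d + 2 * a + 1) (hR : R + l = a + d)
    {v : ℕ} (hv : 0 < v) :
    combHeight M R d l v = combHeight M R d l (combParent M R v) ↔
      (d < v % M + l ∧ v % M ≤ R) ∨ R + l < v % M := by
  have hlt := Nat.mod_lt v (show M > 0 by omega)
  unfold combHeight
  rcases combParent_cases (M := M) (R := R) (by omega) (by omega) hv with
    ⟨h, h1, -⟩ | ⟨h, h1, -⟩ | ⟨h, h', h1, -⟩ <;> split_ifs <;> omega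

theorem combHeight_of_eq (hl : l < d) (hM : M = d + 2 * a + 1) (hR : R + l = a + d)
    {v : ℕ} (hv : 0 < v) (h : combHeight M R d l v = combHeight M R d l (combParent M R v)) :
    combParent M R v / M = v / M ∧
      ((combHeight M R d l v = d ∧ d < v % M + l ∧ v % M ≤ R) ∨
       (combHeight M R d l v = 0 ∧ R + l < v % M)) := by
  have h0 := (combHeight_eq_iff hl hM hR hv).1 h
  have hlt := Nat.mod_lt v (show M > 0 by omega)
  unfold combHeight
  rcases combParent_cases (M := M) (R := R) (by omega) (by omega) hv with
    ⟨h, h1, h2⟩ | ⟨h, h1, h2⟩ | ⟨h, h', h1, h2⟩ <;> refine ⟨by omega, ?_⟩ <;> split_ifs <;> omega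

/-- A lower bound for the number of positive edges between the left or right negative path of block
`b` and a vertex of height `h` in block `i`. It need not grow with `i` beyond block `b + 1`, and is
constant on the blocks before `b`. -/
def legDist (d l : ℕ) (right : Prop) [Decidable right] (b i h : ℕ) : ℕ :=
  if i < b then (if right then d - l else l)
  else if i = b then (if right then d - h else h)
  else (if right then d - l else l + 2) + ((h - l) + (l - h))

theorem combHeight_le (hl : l < d) (v : ℕ) : combHeight M R d l v ≤ d := by
  unfold combHeight; split_ifs <;> omega

theorem comb_edge_cases (hl : l < d) (hM : M = d + 2 * a + 1) (hR : R + l = a + d)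
    {v : ℕ} (hv : 0 < v) :
    (combParent M R v / M + 1 = v / M ∧ combHeight M R d l v = l ∧
      combHeight M R d l (combParent M R v) = l + 1) ∨
    (combParent M R v / M = v / M ∧
      (combHeight M R d l v ≤ combHeight M R d l (combParent M R v) + 1 ∧
      combHeight M R d l (combParent M R v) ≤ combHeight M R d l v + 1)) := by
  have hlt := Nat.mod_lt v (show M > 0 by omega)
  unfold combHeight
  rcases combParent_cases (M := M) (R := R) (by omega) (by omega) hv with
    ⟨h, h1, h2⟩ | ⟨h, h1, h2⟩ | ⟨h, h', h1, h2⟩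
  · left; refine ⟨h2, ?_⟩; split_ifs <;> omega
  · right; refine ⟨h2, ?_⟩; split_ifs <;> omega
  · right; refine ⟨h2, ?_⟩; split_ifs <;> omega

theorem legDist_lipschitz (hl : l < d) (hM : M = d + 2 * a + 1) (hR : R + l = a + d)
    (right : Prop) [Decidable right] (b : ℕ) {v : ℕ} (hv : 0 < v) {D : ℕ → ℕ}
    (hD : D = fun v => legDist d l right b (v / M) (combHeight M R d l v)) :
    (D v ≤ D (combParent M R v) + 1 ∧ D (combParent M R v) ≤ D v + 1) ∧
    (combHeight M R d l v = combHeight M R d l (combParent M R v) →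
      D v = D (combParent M R v)) := by
  have h1 := comb_edge_cases (M := M) hl hM hR hv
  have h2 := combHeight_le (M := M) (R := R) hl v
  have h3 := combHeight_le (M := M) (R := R) hl (combParent M R v)
  subst hD
  simp only [legDist]
  generalize combHeight M R d l v = x at *
  generalize combHeight M R d l (combParent M R v) = y at *
  generalize v / M = i at *
  generalize combParent M R v / M = i' at *
  split_ifs <;> omega

variable {L : ℕ}

/-- A connected subgraph meeting two different negative paths has at least `d` positive edges. The
path to the left is taken as the origin of `legDist`. -/
theorem comb_separated (hl : l < d) (hM : M = d + 2 * a + 1) (hR : R + l = a + d)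
    (hl1 : d ≤ 2 * l + 2) (hl2 : 2 * l + 1 ≤ d)
    {H : (parentGraph L (combParent M R)).Subgraph} (hH : H.Connected)
    {u v : Fin (L + 1)} (hu : u ∈ H.verts) (hv : v ∈ H.verts)
    (hu0 : combHeight M R d l u = 0 ∨ combHeight M R d l u = d)
    (hv0 : combHeight M R d l v = 0 ∨ combHeight M R d l v = d)
    (huv : u.1 / M < v.1 / M ∨ (u.1 / M = v.1 / M ∧
      combHeight M R d l u = 0 ∧ combHeight M R d l v = d)) :
    d ≤ (H.edgeSet ∩ {e | levelWeight (fun x : Fin (L + 1) => combHeight M R d l x) e = 1}).ncard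
    := by
  set D : ℕ → ℕ := fun x => legDist d l (combHeight M R d l u = d) (u.1 / M) (x / M)
    (combHeight M R d l x) with hD
  refine hH.le_ncard_of_lipschitz (fun x => D x.1) _ ?_ hu hv ?_ ?_
  · intro x y hxy hlt
    have hadj := hxy.adj_sub
    rcases hadj with ⟨h, h'⟩ | ⟨h, h'⟩
    · have h1 := legDist_lipschitz hl hM hR _ _ (by omega : 0 < x.1) hD
      rw [h'] at h1
      refine ⟨by omega, ?_⟩
      rw [Set.mem_ofPred_eq, levelWeight_mk, if_neg]
      intro h2
      have := h1.2 h2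
      omega
    · have h1 := legDist_lipschitz hl hM hR _ _ (by omega : 0 < y.1) hD
      rw [h'] at h1
      refine ⟨by omega, ?_⟩
      rw [Set.mem_ofPred_eq, levelWeight_mk, if_neg]
      intro h2
      have := h1.2 h2.symm
      omega
  · simp only [hD, legDist]
    split_ifs <;> omega
  · simp only [hD, legDist]
    generalize combHeight M R d l u = x at *
    generalize combHeight M R d l v = y at *
    generalize u.1 / M = i at *
    generalize v.1 / M = i' at *
    split_ifs <;> omega

/-- There are at most `B` edges `f v` with `v + 1` among `B` given consecutive numbers. -/
theorem ncard_leg_le {L : ℕ} {A B : ℕ} (f : Fin L → Sym2 (Fin (L + 1))) :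
    (f '' {v | A < v.1 + 1 ∧ v.1 + 1 ≤ A + B}).ncard ≤ B := by
  refine (Set.ncard_image_le (Set.toFinite _)).trans ?_
  rw [← Set.ncard_image_of_injective _ Fin.val_injective]
  refine (Set.ncard_le_ncard (t := (Finset.Ico A (A + B) : Set ℕ)) ?_ (Set.toFinite _)).trans ?_
  · rintro _ ⟨v, ⟨h1, h2⟩, rfl⟩
    simp only [Finset.coe_Ico, Set.mem_Ico]
    omega
  · rw [Set.ncard_coe_finset, Nat.card_Ico]; omega

/-- A connected subgraph with `a + d` edges meets one negative path only, which has `a` edges, or it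
has at least `d` positive edges; it has at most `a` negative edges in both cases. -/
theorem comb_ncard_neg_le (had : a < d) (hl : l < d) (hM : M = d + 2 * a + 1)
    (hR : R + l = a + d) (hl1 : d ≤ 2 * l + 2) (hl2 : 2 * l + 1 ≤ d)
    {H : (parentGraph L (combParent M R)).Subgraph} (hH : H.Connected)
    (hk : H.edgeSet.ncard = a + d) :
    (H.edgeSet ∩ {e | levelWeight (fun x : Fin (L + 1) => combHeight M R d l x) e = -1}).ncard ≤ a
    := by
  set w := levelWeight fun x : Fin (L + 1) => combHeight M R d l x with hw
  have hw1 : ∀ e, w e = -1 ∨ w e = 1 := levelWeight_eq _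
  have hsplit : (H.edgeSet ∩ {e | w e = -1}).ncard + (H.edgeSet ∩ {e | w e = 1}).ncard =
      a + d := by
    rw [← hk, ← Set.ncard_union_eq ?_ (Set.toFinite _) (Set.toFinite _),
      ← Set.inter_union_distrib_left]
    · congr 1
      refine Set.inter_eq_left.2 fun e _ => hw1 e
    · rw [Set.disjoint_left]
      rintro e ⟨_, h1⟩ ⟨_, h2⟩
      simp only [Set.mem_ofPred_eq] at h1 h2
      omega
  have hp := combParent_lt (M := M) (R := R) (by omega)
  -- A negative edge lies on the right or on the left negative path of its block.
  have hneg : ∀ e ∈ H.edgeSet ∩ {e | w e = -1}, ∃ v : Fin L, childEdge hp v = e ∧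
      v.succ ∈ H.verts ∧
      ((combHeight M R d l (v.1 + 1) = d ∧ d < (v.1 + 1) % M + l ∧ (v.1 + 1) % M ≤ R) ∨
       (combHeight M R d l (v.1 + 1) = 0 ∧ R + l < (v.1 + 1) % M)) := by
    rintro e ⟨heH, hew⟩
    have he := H.edgeSet_subset heH
    rw [edgeSet_parentGraph hp] at he
    obtain ⟨v, rfl⟩ := he
    refine ⟨v, rfl, H.edge_vert heH, ?_⟩
    rw [Set.mem_ofPred_eq, hw, childEdge, levelWeight_mk] at hew
    refine (combHeight_of_eq hl hM hR (Nat.succ_pos v.1) ?_).2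
    by_contra h
    rw [if_neg (by simpa using h)] at hew
    omega
  rcases (H.edgeSet ∩ {e | w e = -1}).eq_empty_or_nonempty with h0 | ⟨e₀, he₀⟩
  · simp [h0]
  obtain ⟨v₀, hv₀, hvH₀, hleg₀⟩ := hneg e₀ he₀
  by_cases hsep : ∀ e ∈ H.edgeSet ∩ {e | w e = -1}, ∃ v : Fin L, childEdge hp v = e ∧
      (v.1 + 1) / M = (v₀.1 + 1) / M ∧
      ((d < (v₀.1 + 1) % M + l ∧ (v₀.1 + 1) % M ≤ R ∧
        d < (v.1 + 1) % M + l ∧ (v.1 + 1) % M ≤ R) ∨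
      (R + l < (v₀.1 + 1) % M ∧ R + l < (v.1 + 1) % M))
  · have hMpos : 0 < M := by omega
    have hmod : ∀ v : ℕ, v = M * (v / M) + v % M := fun v => (Nat.div_add_mod v M).symm
    rcases hleg₀ with ⟨-, h1, h2⟩ | ⟨-, h1⟩
    · refine (Set.ncard_le_ncard (fun e he => ?_) (Set.toFinite _)).trans
        (ncard_leg_le (A := M * ((v₀.1 + 1) / M) + (d - l)) (B := a) (childEdge hp))
      obtain ⟨v, rfl, hv, hv'⟩ := hsep e he
      refine ⟨v, ?_, rfl⟩
      have h3 := hmod (v.1 + 1)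
      rw [hv] at h3
      simp only [Set.mem_ofPred_eq]
      omega
    · refine (Set.ncard_le_ncard (fun e he => ?_) (Set.toFinite _)).trans
        (ncard_leg_le (A := M * ((v₀.1 + 1) / M) + (R + l)) (B := a) (childEdge hp))
      obtain ⟨v, rfl, hv, hv'⟩ := hsep e he
      refine ⟨v, ?_, rfl⟩
      have h3 := hmod (v.1 + 1)
      have h4 := Nat.mod_lt (v.1 + 1) hMpos
      rw [hv] at h3
      simp only [Set.mem_ofPred_eq]
      omega
  · simp only [not_forall, not_exists, not_and] at hsep
    obtain ⟨e, he, hsep⟩ := hsep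
    obtain ⟨v, hv, hvH, hleg⟩ := hneg e he
    have hsep := hsep v hv
    have h1 : (v.succ : Fin (L + 1)).1 = v.1 + 1 := rfl
    have h2 : (v₀.succ : Fin (L + 1)).1 = v₀.1 + 1 := rfl
    have hl0 := (hleg.imp (·.1) (·.1)).symm
    have hl0' := (hleg₀.imp (·.1) (·.1)).symm
    have hd : d ≤ (H.edgeSet ∩ {e | w e = 1}).ncard := by
      by_cases hlt : (v.1 + 1) / M < (v₀.1 + 1) / M ∨ ((v.1 + 1) / M = (v₀.1 + 1) / M ∧
        combHeight M R d l (v.1 + 1) = 0 ∧ combHeight M R d l (v₀.1 + 1) = d)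
      · exact comb_separated hl hM hR hl1 hl2 hH hvH hvH₀ hl0 hl0'
          hlt
      · refine comb_separated hl hM hR hl1 hl2 hH hvH₀ hvH hl0' hl0
          ?_
        rw [h1, h2]
        rcases Nat.lt_trichotomy ((v.1 + 1) / M) ((v₀.1 + 1) / M) with h | h | h
        · exact absurd (.inl h) hlt
        · rcases hleg with ⟨x1, x2, x3⟩ | ⟨x1, x2⟩ <;> rcases hleg₀ with ⟨y1, y2, y3⟩ | ⟨y1, y2⟩
          · exact absurd (.inl ⟨y2, y3, x2, x3⟩) (hsep h)
          · exact .inr ⟨h.symm, y1, x1⟩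
          · exact absurd (.inr ⟨h, x1, y1⟩) hlt
          · exact absurd (.inr ⟨y2, x2⟩) (hsep h)
        · exact .inl h
    clear hsep hleg hleg₀ hl0 hl0' hneg
    omega

theorem comb_isLocalPositive (had : a < d) (hl : l < d) (hM : M = d + 2 * a + 1)
    (hR : R + l = a + d) (hl1 : d ≤ 2 * l + 2) (hl2 : 2 * l + 1 ≤ d) :
    FinGraph.IsLocalPositive ⟨L + 1, parentGraph L (combParent M R)⟩ (a + d)
      (levelWeight fun x : Fin (L + 1) => combHeight M R d l x) := by
  refine ⟨fun e _ => levelWeight_eq _ e, fun H hH hk => ?_⟩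
  have h := comb_ncard_neg_le had hl hM hR hl1 hl2 hH hk
  refine lt_of_lt_of_eq ?_ (FinGraph.weight_eq_ncard
    (G := ⟨L + 1, parentGraph L (combParent M R)⟩) _ H.edgeSet fun e _ => levelWeight_eq _ e).symm
  rw [hk]
  zify at h
  push_cast
  refine sub_pos.2 ((mul_le_mul_of_nonneg_left h zero_le_two).trans_lt ?_)
  omega

theorem sum_range_mul_mod (f : ℕ → ℤ) (M n : ℕ) :
    ∑ v ∈ Finset.range (n * M), f (v % M) = n * ∑ j ∈ Finset.range M, f j := by
  induction n with
  | zero => simp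
  | succ n ih =>
    rw [Nat.succ_mul, Finset.sum_range_add, ih]
    have : ∑ x ∈ Finset.range M, f ((n * M + x) % M) = ∑ j ∈ Finset.range M, f j :=
      Finset.sum_congr rfl fun x hx => by
        rw [Nat.mul_add_mod', Nat.mod_eq_of_lt (Finset.mem_range.1 hx)]
    rw [this]
    push_cast
    ring

theorem comb_totalWeight (hl : l < d) (hM : M = d + 2 * a + 1) (hR : R + l = a + d)
    {n : ℕ} (hL : L + 1 = n * M) :
    FinGraph.totalWeight ⟨L + 1, parentGraph L (combParent M R)⟩
      (levelWeight fun x : Fin (L + 1) => combHeight M R d l x) =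
      n * (d + 1 - 2 * a) - 1 := by
  set f : ℕ → ℤ := fun j => if (d < j + l ∧ j ≤ R) ∨ R + l < j then -1 else 1 with hf
  have hp := combParent_lt (M := M) (R := R) (by omega)
  rw [totalWeight_parentGraph hp]
  have h1 : ∀ v : Fin L, levelWeight (fun x : Fin (L + 1) => combHeight M R d l x)
      (childEdge hp v) = f ((v.1 + 1) % M) := by
    intro v
    rw [childEdge, levelWeight_mk]
    exact if_congr (combHeight_eq_iff hl hM hR (Nat.succ_pos v.1)) rfl rfl
  have hf0 : f 0 = 1 := by
    simp only [hf]; rw [if_neg]; omega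
  have h2 : ∑ j ∈ Finset.range M, f j = d + 1 - 2 * a := by
    have hMs : M = ((d - l + 1) + a + l) + a := by omega
    have e1 : ∑ j ∈ Finset.range (d - l + 1), f j = ∑ j ∈ Finset.range (d - l + 1), 1 :=
      Finset.sum_congr rfl fun j hj => by
        have := Finset.mem_range.1 hj
        simp only [hf]; rw [if_neg]; omega
    have e2 : ∑ j ∈ Finset.range a, f ((d - l + 1) + j) = ∑ j ∈ Finset.range a, -1 :=
      Finset.sum_congr rfl fun j hj => by
        have := Finset.mem_range.1 hj
        simp only [hf]; rw [if_pos]; omega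
    have e3 : ∑ j ∈ Finset.range l, f ((d - l + 1) + a + j) = ∑ j ∈ Finset.range l, 1 :=
      Finset.sum_congr rfl fun j hj => by
        have := Finset.mem_range.1 hj
        simp only [hf]; rw [if_neg]; omega
    have e4 : ∑ j ∈ Finset.range a, f ((d - l + 1) + a + l + j) = ∑ j ∈ Finset.range a, -1 :=
      Finset.sum_congr rfl fun j hj => by
        have := Finset.mem_range.1 hj
        simp only [hf]; rw [if_pos]; omega
    rw [hMs, Finset.sum_range_add, Finset.sum_range_add, Finset.sum_range_add, e1, e2, e3, e4]
    simp
    omega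
  have h3 := sum_range_mul_mod f M n
  rw [← hL, Finset.sum_range_succ', Nat.zero_mod, hf0, h2] at h3
  rw [Finset.sum_congr rfl fun v _ => h1 v, Fin.sum_univ_eq_sum_range (fun v => f ((v + 1) % M))]
  linarith

/-- A comb with `n + 1` blocks. The choice `l = (d - 1) / 2` puts the middle edge of a block onto
the spine, which keeps the negative paths of neighbouring blocks at distance `d`. -/
theorem exists_comb_tree (a d : ℕ) (had : a < d) (n : ℕ) :
    ∃ G ∈ trees 3, G.numEdges + 1 = (n + 1) * (d + 2 * a + 1) ∧ ∃ w, G.IsLocalPositive (a + d) w ∧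
      G.totalWeight w = (n + 1) * (d + 1 - 2 * a : ℤ) - 1 := by
  classical
  obtain ⟨L, hL⟩ : ∃ L, L + 1 = (n + 1) * (d + 2 * a + 1) :=
    ⟨(n + 1) * (d + 2 * a + 1) - 1, Nat.sub_add_cancel (Nat.mul_pos (by omega) (by omega))⟩
  have hp := combParent_lt (M := d + 2 * a + 1) (R := a + d - (d - 1) / 2) (by omega)
  refine ⟨⟨L + 1, parentGraph L (combParent (d + 2 * a + 1) (a + d - (d - 1) / 2))⟩,
    ⟨parentGraph_isTree hp, ?_⟩, ?_, _,
    comb_isLocalPositive (l := (d - 1) / 2) had (by omega) rfl (by omega)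
      (by omega) (by omega), ?_⟩
  · exact parentGraph_maxDegree_le
      (q := fun u => if u % (d + 2 * a + 1) = 0 then u + (a + d - (d - 1) / 2 + 1)
        else u + (d + 2 * a + 1) - 1) (combParent_branching (M := d + 2 * a + 1)
      (R := a + d - (d - 1) / 2) (by omega) (by omega))
  · rw [← hL]
    exact congrArg (· + 1) (ncard_edgeSet_parentGraph hp)
  · have := comb_totalWeight (a := a) (d := d) (l := (d - 1) / 2) (R := a + d - (d - 1) / 2)
      (by omega) rfl (by omega) hL
    push_cast at this
    exact this

end Comb

/-! ### Upper bounds for the total weight -/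

theorem trees_mono {Δ Δ' : ℕ} (h : Δ ≤ Δ') : trees Δ ⊆ trees Δ' := fun _ hG => ⟨hG.1, hG.2.trans h⟩

section UpperBounds

variable {a d : ℕ} {𝒢 : Set FinGraph}

theorem exists_comb_family (had : a < d) (h𝒢 : trees 3 ⊆ 𝒢) : ∃ (G : ℕ → FinGraph)
    (w : ∀ n, Sym2 (G n).V → ℤ), Function.Injective G ∧ ∀ n, G n ∈ 𝒢 ∧
      (G n).IsLocalPositive (a + d) (w n) ∧
      (G n).numEdges + 1 = (n + 1) * (d + 2 * a + 1) ∧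
      (G n).totalWeight (w n) = (n + 1) * (d + 1 - 2 * a : ℤ) - 1 := by
  choose G hG hE w hw ht using exists_comb_tree a d had
  refine ⟨G, w, fun m n hmn => ?_, fun n => ⟨h𝒢 (hG n), hw n, hE n, ht n⟩⟩
  have h1 := hE m
  rw [hmn, hE n] at h1
  have := Nat.eq_of_mul_eq_mul_right (by omega) h1
  omega

/-- What holds for almost all graphs of the family holds arbitrarily far out in any sequence of
distinct members. -/
theorem ForAlmostAll.exists_ge {P : FinGraph → Prop} (h : ForAlmostAll 𝒢 P) {G : ℕ → FinGraph}
    (hG : Function.Injective G) (hG𝒢 : ∀ n, G n ∈ 𝒢) (N : ℕ) : ∃ n, N ≤ n ∧ P (G n) := by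
  by_contra! hn
  refine (Set.infinite_of_injective_forall_mem (f := fun n => G (N + n))
    (fun m n hmn => by simpa using hG hmn) fun n => ?_) h
  exact ⟨hG𝒢 _, hn _ (by omega)⟩

theorem not_forcing (had : a < d) (had' : d + 1 ≤ 2 * a) (h𝒢 : trees 3 ⊆ 𝒢) :
    ¬ Forcing 𝒢 (a + d) := by
  intro hf
  obtain ⟨G, w, hinj, h⟩ := exists_comb_family had h𝒢
  obtain ⟨n, -, hn⟩ := ForAlmostAll.exists_ge hf hinj (fun n => (h n).1) 0
  have h1 := hn _ (h n).2.1
  rw [(h n).2.2.2] at h1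
  have : ((n : ℤ) + 1) * (d + 1 - 2 * a) ≤ 0 :=
    mul_nonpos_of_nonneg_of_nonpos (by omega) (by omega)
  omega

theorem lowerConstants_le_neg_one (had : a < d) (had' : d + 1 = 2 * a) (h𝒢 : trees 3 ⊆ 𝒢) {C : ℝ}
    (hC : C ∈ lowerConstants 𝒢 (a + d)) : C ≤ -1 := by
  obtain ⟨G, w, hinj, h⟩ := exists_comb_family had h𝒢
  obtain ⟨n, -, hn⟩ := ForAlmostAll.exists_ge hC hinj (fun n => (h n).1) 0
  have h1 := hn _ (h n).2.1
  have h2 : (d + 1 - 2 * a : ℤ) = 0 := by omega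
  rw [(h n).2.2.2, h2] at h1
  simpa using h1

theorem lowerConstants_eq_empty (had : a < d) (had' : d + 1 < 2 * a) (h𝒢 : trees 3 ⊆ 𝒢) :
    lowerConstants 𝒢 (a + d) = ∅ := by
  refine Set.eq_empty_iff_forall_notMem.2 fun C hC => ?_
  obtain ⟨G, w, hinj, h⟩ := exists_comb_family had h𝒢
  obtain ⟨N, hN⟩ := exists_nat_gt (-C)
  obtain ⟨n, hNn, hn⟩ := ForAlmostAll.exists_ge hC hinj (fun n => (h n).1) N
  have h1 := hn _ (h n).2.1
  have h2 : (G n).totalWeight (w n) ≤ -(n : ℤ) := by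
    rw [(h n).2.2.2]
    have : (d + 1 - 2 * a : ℤ) ≤ -1 := by omega
    nlinarith
  have h3 : ((G n).totalWeight (w n) : ℝ) ≤ -(n : ℝ) := by exact_mod_cast h2
  have h4 : (N : ℝ) ≤ n := by exact_mod_cast hNn
  linarith

theorem collapseConstant_le (had : a < d) (had' : d + 1 ≤ 2 * a) (h𝒢 : trees 3 ⊆ 𝒢) :
    collapseConstant 𝒢 (a + d) ≤ -((2 * a - d - 1 : ℝ) / (2 * a + d + 1)) := by
  refine (isLUB_collapseConstant 𝒢 (a + d)).2 ?_
  rintro c ⟨-, g, hg, hc⟩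
  obtain ⟨G, w, hinj, h⟩ := exists_comb_family had h𝒢
  have hM : (0 : ℝ) < 2 * a + d + 1 := by positivity
  have hD : (d : ℝ) + 1 ≤ 2 * a := by exact_mod_cast had'
  refine le_of_forall_pos_le_add fun ε hε => ?_
  obtain ⟨N, hN⟩ := eventually_atTop.1 ((isLittleO_iff.1 hg) hε)
  obtain ⟨hmem, hw, hE, ht⟩ := h (N + 1)
  have hEN : N < (G (N + 1)).numEdges := by nlinarith
  have h1 := hN _ hEN.le
  have h2 := hc _ hmem _ hw
  have hE' : ((G (N + 1)).numEdges : ℝ) + 1 = (N + 1 + 1) * (2 * a + d + 1) := by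
    have : (((G (N + 1)).numEdges + 1 : ℕ) : ℝ) = (((N + 1 + 1) * (d + 2 * a + 1) : ℕ) : ℝ) := by
      rw [hE]
    push_cast at this
    linarith
  have ht' : ((G (N + 1)).totalWeight (w (N + 1)) : ℝ) = (N + 1 + 1) * (d + 1 - 2 * a) - 1 := by
    rw [ht]; push_cast; ring
  rw [ht'] at h2
  have hEpos : (0 : ℝ) < (G (N + 1)).numEdges := by
    exact_mod_cast (Nat.zero_le N).trans_lt hEN
  rw [Real.norm_eq_abs, Real.norm_eq_abs, abs_of_pos hEpos] at h1
  have h3 := (le_abs_self _).trans h1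
  generalize ((G (N + 1)).numEdges : ℝ) = E at *
  -- With `x` the claimed bound, `(N + 2) * (d + 1 - 2 * a) = (E + 1) * x`.
  set x : ℝ := -((2 * a - d - 1 : ℝ) / (2 * a + d + 1)) with hx
  have hx0 : x ≤ 0 := neg_nonpos.2 (div_nonneg (by linarith) hM.le)
  have hxM : x * (2 * a + d + 1) = d + 1 - 2 * a := by
    rw [hx]; field_simp; ring
  have h4 : ((N : ℝ) + 1 + 1) * (d + 1 - 2 * a) = (E + 1) * x := by
    rw [hE', ← hxM]; ring
  rw [h4] at h2
  have h5 : (c - ε) * E ≤ x * E := by nlinarith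
  linarith [le_of_mul_le_mul_right h5 hEpos]

theorem collapses (had : a < d) (had' : d + 1 < 2 * a) (h𝒢 : trees 3 ⊆ 𝒢) :
    Collapses 𝒢 (a + d) :=
  ⟨not_forcing had had'.le h𝒢, fun h => by
    have := h.2
    rw [lowerConstants_eq_empty had had' h𝒢] at this
    exact Set.not_nonempty_empty this⟩

theorem weaklyForcingWith_neg_one {Δ : ℕ} (hka : d ≤ a + 2)
    (had : a < d) (had' : d + 1 = 2 * a) (h𝒢 : trees 3 ⊆ 𝒢) (h𝒢' : 𝒢 ⊆ connectedGraphs (Δ + 1)) :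
    WeaklyForcingWith 𝒢 (a + d) (-1) := by
  have hmem : (-1 : ℝ) ∈ lowerConstants 𝒢 (a + d) :=
    forAlmostAll_neg_one_le rfl (by omega) had (by omega) h𝒢'
  exact ⟨⟨not_forcing had had'.le h𝒢, -1, hmem⟩, hmem,
    fun C hC => lowerConstants_le_neg_one had had' h𝒢 hC⟩

theorem collapse_bounds {Δ : ℕ} (hka : d ≤ a + 2) (had : a < d) (had' : d + 1 < 2 * a)
    (h𝒢 : trees 3 ⊆ 𝒢) (h𝒢' : 𝒢 ⊆ connectedGraphs (Δ + 1)) :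
    collapseConstant 𝒢 (a + d) ≤ -((2 * a - d - 1 : ℝ) / (2 * a + d + 1)) ∧
    -((2 * a - d : ℝ) / (2 * a + d)) ≤ collapseConstant 𝒢 (a + d) :=
  ⟨collapseConstant_le had had'.le h𝒢, (isLUB_collapseConstant 𝒢 (a + d)).1
    (mem_collapseRates rfl (by omega) (by omega) (by omega) (by omega) h𝒢')⟩

end UpperBounds

theorem theorem2 :
    (∀ 𝒢 : Set FinGraph, trees 2 ⊆ 𝒢 → 𝒢 ⊆ connectedGraphs 2 →
      ∀ k : ℕ, 1 ≤ k → Forcing 𝒢 k) ∧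
    (∀ Δ : ℕ, 3 ≤ Δ → ∀ 𝒢 : Set FinGraph, trees Δ ⊆ 𝒢 → 𝒢 ⊆ connectedGraphs Δ →
      (Forcing 𝒢 1 ∧ Forcing 𝒢 2 ∧ Forcing 𝒢 3 ∧ Forcing 𝒢 4 ∧ Forcing 𝒢 6) ∧
      (WeaklyForcingWith 𝒢 5 (-1) ∧ WeaklyForcingWith 𝒢 8 (-1)) ∧
      (∀ k : ℕ, k = 7 ∨ 9 ≤ k →
        Collapses 𝒢 k ∧
        ∀ m : ℕ,
          (k = 4 * m + 3 →
            collapseConstant 𝒢 k ≤ -((2 * (m : ℝ) - 1) / (6 * (m : ℝ) + 5)) ∧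
            -((m : ℝ) / (3 * (m : ℝ) + 2)) ≤ collapseConstant 𝒢 k) ∧
          (k = 4 * m + 2 →
            collapseConstant 𝒢 k ≤ -((2 * (m : ℝ) - 3) / (6 * (m : ℝ) + 3)) ∧
            -(((m : ℝ) - 1) / (3 * (m : ℝ) + 1)) ≤ collapseConstant 𝒢 k) ∧
          (k = 4 * m + 1 →
            collapseConstant 𝒢 k ≤ -(((m : ℝ) - 1) / (3 * (m : ℝ) + 1)) ∧
            -((2 * (m : ℝ) - 1) / (6 * (m : ℝ) + 1)) ≤ collapseConstant 𝒢 k) ∧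
          (k = 4 * m →
            collapseConstant 𝒢 k ≤ -(((m : ℝ) - 2) / (3 * (m : ℝ))) ∧
            -((2 * (m : ℝ) - 3) / (6 * (m : ℝ) - 1)) ≤ collapseConstant 𝒢 k))) := by
  refine ⟨fun 𝒢 _ h𝒢' k hk => forcing_of_path hk h𝒢', fun Δ hΔ 𝒢 h𝒢 h𝒢' => ?_⟩
  have ht : trees 3 ⊆ 𝒢 := (trees_mono hΔ).trans h𝒢
  obtain ⟨Δ, rfl⟩ : ∃ D, Δ = D + 1 := ⟨Δ - 1, by omega⟩
  refine ⟨⟨?_, ?_, ?_, ?_, ?_⟩, ⟨?_, ?_⟩, fun k hk => ⟨?_, fun m => ⟨?_, ?_, ?_, ?_⟩⟩⟩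
  · exact forcing_of_two_mul_le (a := 0) (d := 1) rfl (by omega) (by omega) (by omega) h𝒢'
  · exact forcing_of_two_mul_le (a := 0) (d := 2) rfl (by omega) (by omega) (by omega) h𝒢'
  · exact forcing_of_two_mul_le (a := 1) (d := 2) rfl (by omega) (by omega) (by omega) h𝒢'
  · exact forcing_of_two_mul_le (a := 1) (d := 3) rfl (by omega) (by omega) (by omega) h𝒢'
  · exact forcing_of_two_mul_le (a := 2) (d := 4) rfl (by omega) (by omega) (by omega) h𝒢'
  · exact weaklyForcingWith_neg_one (a := 2) (d := 3) (by omega) (by omega) (by omega) ht h𝒢'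
  · exact weaklyForcingWith_neg_one (a := 3) (d := 5) (by omega) (by omega) (by omega) ht h𝒢'
  · have := collapses (a := (k - 1) / 2) (d := k - (k - 1) / 2) (by omega) (by omega) ht
    rwa [Nat.add_sub_cancel' (by omega)] at this
  · intro hm
    have := collapse_bounds (a := 2 * m + 1) (d := 2 * m + 2) (by omega) (by omega) (by omega)
      ht h𝒢'
    rw [show 2 * m + 1 + (2 * m + 2) = k by omega] at this
    push_cast at this
    convert this using 2
    · congr 1; congr 1 <;> ring
    · rw [neg_inj, div_eq_div_iff (by positivity) (by positivity)]; ring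
  · intro hm
    have := collapse_bounds (a := 2 * m) (d := 2 * m + 2) (by omega) (by omega) (by omega)
      ht h𝒢'
    rw [show 2 * m + (2 * m + 2) = k by omega] at this
    push_cast at this
    convert this using 2
    · congr 1; congr 1 <;> ring
    · rw [neg_inj, div_eq_div_iff (by positivity) (by positivity)]; ring
  · intro hm
    have := collapse_bounds (a := 2 * m) (d := 2 * m + 1) (by omega) (by omega) (by omega)
      ht h𝒢'
    rw [show 2 * m + (2 * m + 1) = k by omega] at this
    push_cast at this
    convert this using 2
    · rw [neg_inj, div_eq_div_iff (by positivity) (by positivity)]; ring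
    · congr 1; congr 1 <;> ring
  · intro hm
    -- `k ≥ 9` gives `m ≥ 1`, so that no subtraction of naturals is needed.
    obtain ⟨m, rfl⟩ : ∃ j, m = j + 1 := ⟨m - 1, by omega⟩
    have := collapse_bounds (a := 2 * m + 1) (d := 2 * m + 3) (by omega) (by omega) (by omega)
      ht h𝒢'
    rw [show 2 * m + 1 + (2 * m + 3) = k by omega] at this
    push_cast at this ⊢
    convert this using 2
    · rw [neg_inj, div_eq_div_iff (by positivity) (by positivity)]; ring
    · congr 1; congr 1 <;> ring
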